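/- Let $(M,g)$ be an oriented smooth Riemannian manifold of dimension 8. A positive orthogonal almost complex structure is an endomorphism $J$ of a tangent space that is $g$-orthogonal, satisfies $J^2=-\mathrm{Id}$ and induces the given orientation; put $\omega_J(u,v)=g(Ju,v)$. A hyper-Kähler triple at $p\in M$ is a triple $(J_1,J_2,J_3)$ of positive orthogonal complex structures of $T_pM$ with $J_1J_2=-J_2J_1=J_3$, and $\mathcal T(M)_p\subset\Lambda^4T_p^*M$ is the set of the 4-forms $\frac16\sum_{i=1}^3\omega_{J_i}\wedge\omega_{J_i}$ of all such triples. An almost quaternionic Hermitian structure $Q$ on $M$ is given by a rank 3 bundle $E\subset\mathrm{End}(TM)$ that is locally spanned by smooth fields of hyper-Kähler triples $(J_1,J_2,J_3)$; its fundamental 4-form is $\Omega=\frac16\sum_{i}\omega_{J_i}\wedge\omega_{J_i}$, which does not depend on the triple. Let $\langle\cdot,\cdot\rangle$ be the inner product on 4-forms for which the forms $e^{i_1}\wedge e^{i_2}\wedge e^{i_3}\wedge e^{i_4}$, $i_1<i_2<i_3<i_4$, of an orthonormal coframe are orthonormal, and let $\Lambda^4_+(TM)$ be the bundle of self-dual 4-forms.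 **Proposition 11.3.** Let $Q_0,Q_1$ be two almost quaternionic Hermitian structures on $(M,g)$, with bundles $E_0,E_1$ and fundamental 4-forms $\Omega_0,\Omega_1$, and let $\theta(p)\in[0,\pi]$ be the angle with $\cos\theta(p)=\frac3{10}\langle\Omega_0(p),\Omega_1(p)\rangle$. 1. If $\dim(E_0\cap E_1)_p\ge 1$ for all $p\in M$, then $\Omega_0$ and $\Omega_1$ are homotopic in $\Lambda^4_+(TM)$ through self-dual 4-forms of constant norm: there is a family $\Omega_t$, $t\in[0,1]$, of self-dual 4-forms on $M$, smooth in $(p,t)\in M\times[0,1]$, joining $\Omega_0$ to $\Omega_1$, with $\langle\Omega_t,\Omega_t\rangle=\frac{10}3$ everywhere. 2. If $\dim(E_0\cap E_1)_p=1$ and $\cos\theta(p)>\frac7{15}$ for all $p\in M$, then $\Omega_0$ and $\Omega_1$ are locally homotopic in $\mathcal T(M)$: every point of $M$ has an open neighbourhood $U$ on which there is a family $\Omega_t$, $t\in[0,1]$, of 4-forms, smooth in $(p,t)\in U\times[0,1]$, joining $\Omega_0|_U$ to $\Omega_1|_U$, with $\Omega_t(p)\in\mathcal T(M)_p$ for all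 $t\in[0,1]$ and $p\in U$. -/

import Mathlib

open scoped Manifold ContDiff Bundle
open Bundle

noncomputable section

/-! ## Linear algebra of an oriented Euclidean 8-space -/

section LinearAlgebra

variable {V : Type*} [NormedAddCommGroup V] [InnerProductSpace ℝ V]

/-- The product `β(v₀, v₁) γ(v₂, v₃)` of two bilinear forms, as a 4-linear form. -/
def bilinProd (β γ : V →ₗ[ℝ] V →ₗ[ℝ] ℝ) : MultilinearMap ℝ (fun _ : Fin 4 => V) ℝ where
  toFun v := β (v 0) (v 1) * γ (v 2) (v 3)
  map_update_add' := by
    intro inst v i x y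
    obtain rfl : inst = instDecidableEqFin 4 := Subsingleton.elim _ _
    fin_cases i <;> simp <;> ring
  map_update_smul' := by
    intro inst v i c x
    obtain rfl : inst = instDecidableEqFin 4 := Subsingleton.elim _ _
    fin_cases i <;> simp <;> ring

/-- The wedge product of two 2-forms, in the convention `(e¹ ∧ e²)(e₁, e₂) = 1`:
`(β ∧ γ)(v₀, v₁, v₂, v₃) = 1/(2! 2!) ∑_σ sign(σ) β(v_{σ0}, v_{σ1}) γ(v_{σ2}, v_{σ3})`. -/
def wedgeTwo (β γ : V →ₗ[ℝ] V →ₗ[ℝ] ℝ) : V [⋀^Fin 4]→ₗ[ℝ] ℝ :=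
  (1 / 4 : ℝ) • MultilinearMap.alternatization (bilinProd β γ)

theorem wedgeTwo_apply (β γ : V →ₗ[ℝ] V →ₗ[ℝ] ℝ) (v : Fin 4 → V) :
   wedgeTwo β γ v = (1/4:ℝ) * ∑ σ : Equiv.Perm (Fin 4), (Equiv.Perm.sign σ : ℤ) *
     (β (v (σ 0)) (v (σ 1)) * γ (v (σ 2)) (v (σ 3))) := by
  simp [wedgeTwo, MultilinearMap.alternatization_apply, bilinProd, Units.smul_def]

/-- The 2-form `ω_J(u, v) = ⟪J u, v⟫` of an endomorphism `J` (it is alternating as soon as `J` is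
an orthogonal complex structure). -/
def kahlerForm (J : V →L[ℝ] V) : V →ₗ[ℝ] V →ₗ[ℝ] ℝ :=
  (innerₗ V).comp J.toLinearMap

/-- `J` is a positive orthogonal complex structure on the oriented Euclidean space `(V, o)`:
a linear isometry with `J² = -1` which induces the orientation `o`, i.e. every basis of the form
`(v₁, J v₁, v₂, J v₂, v₃, J v₃, v₄, J v₄)` is positively oriented. -/
structure IsPosOrthComplexStructure (o : Orientation ℝ V (Fin 8)) (J : V →L[ℝ] V) : Prop where
  isometry : ∀ u v : V, inner ℝ (J u) (J v) = inner ℝ u v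
  sq : ∀ v : V, J (J v) = -v
  positive : ∀ b : Module.Basis (Fin 8) ℝ V,
    b 1 = J (b 0) → b 3 = J (b 2) → b 5 = J (b 4) → b 7 = J (b 6) → b.orientation = o

/-- `(J 0, J 1, J 2)` is a hyper-Kähler triple `(J₁, J₂, J₃ = J₁ J₂)` on `(V, o)`: positive
orthogonal complex structures satisfying the quaternionic relations. -/
structure IsHKTriple (o : Orientation ℝ V (Fin 8)) (J : Fin 3 → V →L[ℝ] V) : Prop where
  complex : ∀ i, IsPosOrthComplexStructure o (J i)
  anticomm : ∀ v : V, J 0 (J 1 v) = -J 1 (J 0 v)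
  mul : ∀ v : V, J 2 v = J 0 (J 1 v)

/-- The fundamental 4-form `Ω = (1/6) (ω₁ ∧ ω₁ + ω₂ ∧ ω₂ + ω₃ ∧ ω₃)` of a triple. -/
def hkForm (J : Fin 3 → V →L[ℝ] V) : V [⋀^Fin 4]→ₗ[ℝ] ℝ :=
  (1 / 6 : ℝ) • ∑ i, wedgeTwo (kahlerForm (J i)) (kahlerForm (J i))

theorem IsHKTriple.inner_eq {o : Orientation ℝ V (Fin 8)} {J : Fin 3 → V →L[ℝ] V}
    (h : IsHKTriple o J) (i k : Fin 3) (u : V) :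
    inner ℝ (J i u) (J k u) = if i = k then inner ℝ u u else 0 := by
  have skew : ∀ i u v, inner ℝ (J i u) v = - inner ℝ u (J i v) := by
    intro i u v
    have := (h.complex i).isometry u (J i v)
    rw [(h.complex i).sq, inner_neg_right] at this
    linarith
  have z : ∀ i u, inner ℝ (J i u) u = (0:ℝ) := by
    intro i u
    have := skew i u u
    rw [real_inner_comm u (J i u)] at this
    rw [real_inner_comm]; linarith
  have h01 : inner ℝ (J 0 u) (J 1 u) = (0:ℝ) := by
    rw [skew, ← h.mul, real_inner_comm, z, neg_zero]
  have h02 : inner ℝ (J 0 u) (J 2 u) = (0:ℝ) := by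
    rw [h.mul, (h.complex 0).isometry, real_inner_comm, z]
  have h12 : inner ℝ (J 1 u) (J 2 u) = (0:ℝ) := by
    rw [h.mul, h.anticomm, inner_neg_right, (h.complex 1).isometry, real_inner_comm, z]; simp
  have a := fun i => (h.complex i).isometry u u
  have h10 := (real_inner_comm (J 0 u) (J 1 u)).trans h01
  have h20 := (real_inner_comm (J 0 u) (J 2 u)).trans h02
  have h21 := (real_inner_comm (J 1 u) (J 2 u)).trans h12
  fin_cases i <;> fin_cases k
  exacts [a 0, h01, h02, h10, a 1, h12, h20, h21, a 2]

/-- The fundamental 4-form depends only on the span of the triple. -/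
theorem hkForm_eq_of_span_eq {o : Orientation ℝ V (Fin 8)} {J J' : Fin 3 → V →L[ℝ] V}
    (h : IsHKTriple o J) (h' : IsHKTriple o J')
    (hs : Submodule.span ℝ (Set.range J') = Submodule.span ℝ (Set.range J)) :
    hkForm J' = hkForm J := by
  have hmem : ∀ i, ∃ c : Fin 3 → ℝ, ∑ j, c j • J j = J' i := by
    intro i
    rw [← Submodule.mem_span_range_iff_exists_fun, ← hs]
    exact Submodule.subset_span ⟨i, rfl⟩
  choose a ha using hmem
  have hV : ∃ u : V, u ≠ 0 ∨ ∀ v : V, v = 0 := by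
    by_cases hh : ∃ u : V, u ≠ 0
    · exact ⟨hh.choose, Or.inl hh.choose_spec⟩
    · push Not at hh; exact ⟨0, Or.inr hh⟩
  obtain ⟨u, hu | h0⟩ := hV
  swap
  · ext v
    rw [show v = 0 from funext fun i => h0 _]
    simp
  have hu' : inner ℝ u u ≠ (0:ℝ) := by simpa using hu
  let A : Matrix (Fin 3) (Fin 3) ℝ := Matrix.of a
  have hA : A * A.transpose = 1 := by
    ext i k
    have := h'.inner_eq i k u
    rw [← ha, ← ha] at this
    simp only [sum_apply, smul_apply, sum_inner, inner_sum,
      inner_smul_left, inner_smul_right, h.inner_eq] at this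
    simp only [Matrix.mul_apply, Matrix.transpose_apply, Matrix.one_apply, A, Matrix.of_apply]
    simp at this
    apply mul_right_cancel₀ hu'
    rw [Finset.sum_mul]
    convert this using 1
    · refine Finset.sum_congr rfl fun x _ => ?_
      simp; ring
    · split_ifs <;> simp
  have hA' := mul_eq_one_comm.mp hA
  have e : ∀ j k, ∑ i, a i j * a i k = if j = k then 1 else 0 := by
    intro j k
    have := congrFun (congrFun hA' j) k
    simpa [Matrix.mul_apply, Matrix.one_apply, A] using this
  have key : ∀ p q r s : V, ∑ i, kahlerForm (J' i) p q * kahlerForm (J' i) r s =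
      ∑ i, kahlerForm (J i) p q * kahlerForm (J i) r s := by
    intro p q r s
    have hk : ∀ i p q, kahlerForm (J' i) p q = ∑ j, a i j * kahlerForm (J j) p q := by
      intro i p q
      simp [kahlerForm, ← ha]
    simp only [hk, Fin.sum_univ_three] at e ⊢
    have e00 := e 0 0; have e01 := e 0 1; have e02 := e 0 2
    have e11 := e 1 1; have e12 := e 1 2; have e22 := e 2 2
    simp at e00 e01 e02 e11 e12 e22
    linear_combination (kahlerForm (J 0) p q * kahlerForm (J 0) r s) * e00 +
      (kahlerForm (J 1) p q * kahlerForm (J 1) r s) * e11 +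
      (kahlerForm (J 2) p q * kahlerForm (J 2) r s) * e22 +
      (kahlerForm (J 0) p q * kahlerForm (J 1) r s + kahlerForm (J 1) p q * kahlerForm (J 0) r s) * e01 +
      (kahlerForm (J 0) p q * kahlerForm (J 2) r s + kahlerForm (J 2) p q * kahlerForm (J 0) r s) * e02 +
      (kahlerForm (J 1) p q * kahlerForm (J 2) r s + kahlerForm (J 2) p q * kahlerForm (J 1) r s) * e12
  ext v
  simp only [hkForm, AlternatingMap.smul_apply, Fin.sum_univ_three, AlternatingMap.add_apply,
    wedgeTwo_apply, ← mul_add, ← Finset.sum_add_distrib]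
  congr 2
  refine Finset.sum_congr rfl fun σ _ => ?_
  have := key (v (σ 0)) (v (σ 1)) (v (σ 2)) (v (σ 3))
  simp only [Fin.sum_univ_three] at this
  rw [this]

/-- The set `𝒯` of fundamental 4-forms of hyper-Kähler triples of `(V, o)`. -/
def hkForms (o : Orientation ℝ V (Fin 8)) : Set (V [⋀^Fin 4]→ₗ[ℝ] ℝ) :=
  {Ω | ∃ J : Fin 3 → V →L[ℝ] V, IsHKTriple o J ∧ Ω = hkForm J}

/-- The 4-form `α` is self-dual, `⋆α = α`. The Hodge star in dimension 8 is characterized by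
`(⋆α)(e₅, e₆, e₇, e₈) = α(e₁, e₂, e₃, e₄)` for all positive orthonormal bases `(e₁, …, e₈)`. -/
def IsSelfDual (o : Orientation ℝ V (Fin 8)) (α : V [⋀^Fin 4]→ₗ[ℝ] ℝ) : Prop :=
  ∀ e : OrthonormalBasis (Fin 8) ℝ V, e.toBasis.orientation = o →
    α ![e 4, e 5, e 6, e 7] = α ![e 0, e 1, e 2, e 3]

/-- The inner product of 4-forms for which the forms `e^{i₁} ∧ e^{i₂} ∧ e^{i₃} ∧ e^{i₄}`,
`i₁ < i₂ < i₃ < i₄`, are orthonormal, for an orthonormal basis `e` (any one of them). -/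
def formInner [FiniteDimensional ℝ V] (α β : V [⋀^Fin 4]→ₗ[ℝ] ℝ) : ℝ :=
  (1 / 24 : ℝ) * ∑ i : Fin 4 → Fin (Module.finrank ℝ V),
    α (fun k => stdOrthonormalBasis ℝ V (i k)) * β (fun k => stdOrthonormalBasis ℝ V (i k))

end LinearAlgebra

/-! ## Manifolds of dimension 8 -/

section Manifold

variable (M : Type*) [TopologicalSpace M] [ChartedSpace (EuclideanSpace ℝ (Fin 8)) M]

instance tangentSpace_finiteDimensional (p : M) : FiniteDimensional ℝ (TangentSpace (𝓡 8) p) :=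
  inferInstanceAs (FiniteDimensional ℝ (EuclideanSpace ℝ (Fin 8)))

/-- A field of 4-forms on `M`, without regularity. -/
abbrev FourFormField : Type _ := ∀ p : M, (TangentSpace (𝓡 8) p) [⋀^Fin 4]→ₗ[ℝ] ℝ

variable [IsManifold (𝓡 8) ∞ M]

/-- The vector field `X` is smooth on `U`. -/
def SmoothVectorFieldOn (U : Set M) (X : ∀ p : M, TangentSpace (𝓡 8) p) : Prop :=
  ContMDiffOn (𝓡 8) (𝓡 8).tangent ∞ (fun p => (⟨p, X p⟩ : TangentBundle (𝓡 8) M)) U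

/-- The field `J` of endomorphisms of the tangent spaces is smooth on `U`. -/
def SmoothEndFieldOn (U : Set M)
    (J : ∀ p : M, TangentSpace (𝓡 8) p →L[ℝ] TangentSpace (𝓡 8) p) : Prop :=
  ContMDiffOn (𝓡 8) ((𝓡 8).prod 𝓘(ℝ, EuclideanSpace ℝ (Fin 8) →L[ℝ] EuclideanSpace ℝ (Fin 8))) ∞
    (fun p => TotalSpace.mk' (EuclideanSpace ℝ (Fin 8) →L[ℝ] EuclideanSpace ℝ (Fin 8))
      (E := fun p : M => TangentSpace (𝓡 8) p →L[ℝ] TangentSpace (𝓡 8) p) p (J p)) U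

/-- The one-parameter family `Ω t`, `t ∈ [0,1]`, of fields of 4-forms is smooth in
`(p, t) ∈ U × [0,1]`: its values on smooth vector fields of open subsets of `U` are smooth
functions of `(p, t)`. -/
def SmoothFormFamilyOn (U : Set M) (Ω : ℝ → FourFormField M) : Prop :=
  ∀ W : Set M, IsOpen W → W ⊆ U → ∀ X : Fin 4 → ∀ p : M, TangentSpace (𝓡 8) p,
    (∀ i, SmoothVectorFieldOn M W (X i)) →
    ContMDiffOn ((𝓡 8).prod 𝓘(ℝ, ℝ)) 𝓘(ℝ, ℝ) ∞
      (fun x : M × ℝ => Ω x.2 x.1 (fun i => X i x.1)) (W ×ˢ Set.Icc (0 : ℝ) 1)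

/-- An orientation of `M`: orientations of the tangent spaces for which there are positive smooth
frames near every point. -/
structure ManifoldOrientation where
  or : ∀ p : M, Orientation ℝ (TangentSpace (𝓡 8) p) (Fin 8)
  exists_frame : ∀ p₀ : M, ∃ U : Set M, IsOpen U ∧ p₀ ∈ U ∧
    ∃ X : Fin 8 → ∀ p : M, TangentSpace (𝓡 8) p, (∀ i, SmoothVectorFieldOn M U (X i)) ∧
      ∀ p ∈ U, ∃ b : Module.Basis (Fin 8) ℝ (TangentSpace (𝓡 8) p),
        (∀ i, b i = X i p) ∧ b.orientation = or p

variable {M}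
variable [RiemannianBundle (fun p : M => TangentSpace (𝓡 8) p)]

/-- An almost quaternionic Hermitian structure on the oriented Riemannian 8-manifold `M`, given
by its rank 3 bundle `E ⊆ End(TM)`, which is locally spanned by smooth triples
`(J₁, J₂, J₃ = J₁ J₂)` of positive orthogonal almost complex structures with `J₁ J₂ = - J₂ J₁`. -/
structure AQHStructure (o : ManifoldOrientation M) where
  E : ∀ p : M, Submodule ℝ (TangentSpace (𝓡 8) p →L[ℝ] TangentSpace (𝓡 8) p)
  exists_local_triple : ∀ p₀ : M, ∃ U : Set M, IsOpen U ∧ p₀ ∈ U ∧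
    ∃ J : Fin 3 → ∀ p : M, TangentSpace (𝓡 8) p →L[ℝ] TangentSpace (𝓡 8) p,
      (∀ i, SmoothEndFieldOn M U (J i)) ∧
      ∀ p ∈ U, IsHKTriple (o.or p) (fun i => J i p) ∧
        E p = Submodule.span ℝ (Set.range fun i => J i p)

namespace AQHStructure

variable {o : ManifoldOrientation M}

theorem exists_triple (Q : AQHStructure o) (p : M) :
    ∃ J : Fin 3 → TangentSpace (𝓡 8) p →L[ℝ] TangentSpace (𝓡 8) p,
      IsHKTriple (o.or p) J ∧ Q.E p = Submodule.span ℝ (Set.range J) := by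
  obtain ⟨U, -, hp, J, -, h⟩ := Q.exists_local_triple p
  exact ⟨fun i => J i p, h p hp⟩

/-- The fundamental 4-form of an almost quaternionic Hermitian structure: at each point, the form
`(1/6) ∑ ω_i ∧ ω_i` of any hyper-Kähler triple spanning `E p`. -/
def fundamentalForm (Q : AQHStructure o) : FourFormField M :=
  fun p => hkForm (Q.exists_triple p).choose

theorem fundamentalForm_eq (Q : AQHStructure o) (p : M)
    {J : Fin 3 → TangentSpace (𝓡 8) p →L[ℝ] TangentSpace (𝓡 8) p}
    (h : IsHKTriple (o.or p) J) (hJ : Q.E p = Submodule.span ℝ (Set.range J)) :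
    Q.fundamentalForm p = hkForm J :=
  hkForm_eq_of_span_eq h (Q.exists_triple p).choose_spec.1
    ((Q.exists_triple p).choose_spec.2.symm.trans hJ)

/-- The angle `θ ∈ [0, π]` between two almost quaternionic Hermitian structures,
`cos θ = (3/10) ⟨Ω₀, Ω₁⟩`. -/
def angle (Q₀ Q₁ : AQHStructure o) (p : M) : ℝ :=
  Real.arccos (3 / 10 * formInner (Q₀.fundamentalForm p) (Q₁.fundamentalForm p))

end AQHStructure

end Manifold

end


/-
On skew endomorphisms `⟨α, β⟩ = -tr (α β) / 8` is an inner product, and expanding in an orthonormal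
basis gives `⟨ω_α ∧ ω_α, ω_β ∧ ω_β⟩ = tr (α β) ^ 2 / 2 - tr (α β α β)`. If `I` is a unit element
of `E₀ ∩ E₁`, and `(I, K, I K)` and `(I, L, I L)` are triples spanning `E₀` and `E₁`, this yields
`⟨Ω₀, Ω₁⟩ = (14 + 16 c²) / 9` where `c² = ⟨K, L⟩² + ⟨K, I L⟩²` is the squared length of the
projection of `K` to `E₁`.

In particular `⟨Ω₀, Ω₁⟩ > 0`, so the segment from `Ω₀` to `Ω₁` avoids `0` and can be rescaled to
constant norm. It consists of self-dual forms because every `Ω` is self-dual: contracting the volume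
form twice with the bivector dual to `ω_J` gives a 4-form that does not depend on the orthonormal
basis used to compute it, and evaluating it in a complex basis identifies it with a multiple of
`ω_J ∧ ω_J`, in a general positive basis with a multiple of its Hodge dual.

The condition `cos θ > 7 / 15` says that `c² > 0`. One may then take for `L` the normalized
projection of `K` to `E₁`, for which `⟨K, I L⟩ = 0` and `⟨K, L⟩ > 0`. Both
`S = K L + L K` and `T = K (I L) + (I L) K` commute with the quaternions generated by `I` and `K`,
so they are Hermitian endomorphisms of `ℍ²`, and `S² + T² = 4`. By Cayley–Hamilton, `T²` is a scalar
as `tr T = 0`, and `S²` is a scalar plus a nonzero multiple of `S` as `tr S ≠ 0`; hence `S` is a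
scalar, and every `γ = (1 - t) K + t L`, normalized, gives a hyper-Kähler triple `(I, γ, I γ)`.
Finally `I` can be chosen smoothly near any point, because
`P₀ P₁ - c² = (1 - c²) ⟨I, ·⟩ I` on `E₀`, where `P₀`, `P₁` are the projections to `E₀`, `E₁`, and
`c² ≠ 1` when `E₀ ∩ E₁` is one-dimensional.
-/

noncomputable section

section FormInner

theorem sum_perm_fin_four {R : Type*} [CommRing R] (f : Fin 4 → Fin 4 → Fin 4 → Fin 4 → R) :
    ∑ σ : Equiv.Perm (Fin 4), ((Equiv.Perm.sign σ : ℤ) : R) * f (σ 0) (σ 1) (σ 2) (σ 3) =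
      f 0 1 2 3 - f 0 1 3 2 - f 0 2 1 3 + f 0 2 3 1 + f 0 3 1 2 - f 0 3 2 1
      - f 1 0 2 3 + f 1 0 3 2 + f 1 2 0 3 - f 1 2 3 0 - f 1 3 0 2 + f 1 3 2 0
      + f 2 0 1 3 - f 2 0 3 1 - f 2 1 0 3 + f 2 1 3 0 + f 2 3 0 1 - f 2 3 1 0
      - f 3 0 1 2 + f 3 0 2 1 + f 3 1 0 2 - f 3 1 2 0 - f 3 2 0 1 + f 3 2 1 0 := by
  have apply_two (n : ℕ) (p : Fin (n + 3)) (σ : Equiv.Perm (Fin (n + 2))) :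
      Equiv.Perm.decomposeFin.symm (p, σ) 2 = Equiv.swap 0 p (σ 1).succ :=
    Equiv.Perm.decomposeFin_symm_apply_succ σ p 1
  have apply_three (p : Fin 4) (σ : Equiv.Perm (Fin 3)) :
      Equiv.Perm.decomposeFin.symm (p, σ) 3 = Equiv.swap 0 p (σ 2).succ :=
    Equiv.Perm.decomposeFin_symm_apply_succ σ p 2
  simp [Finset.univ_perm_fin_succ, ← Finset.univ_product_univ, Finset.sum_product,
    Fin.sum_univ_succ, Equiv.Perm.decomposeFin.symm_sign, apply_two, apply_three,
    Equiv.swap_apply_def]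
  ring

theorem sum_fin_four_fun {ι R : Type*} [Fintype ι] [AddCommMonoid R] (f : ι → ι → ι → ι → R) :
    ∑ i : Fin 4 → ι, f (i 0) (i 1) (i 2) (i 3) = ∑ a, ∑ b, ∑ c, ∑ d, f a b c d := by
  simp only [← (Fin.consEquiv fun _ => ι).sum_comp, Fintype.sum_prod_type]
  simp only [Fin.consEquiv_apply, Fin.cons_zero, Fin.cons_one, Finset.univ_unique,
    Finset.sum_singleton]
  rfl

variable {V : Type*} [NormedAddCommGroup V] [InnerProductSpace ℝ V]

section Bilinear

variable [FiniteDimensional ℝ V]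

theorem formInner_comm (α β : V [⋀^Fin 4]→ₗ[ℝ] ℝ) : formInner α β = formInner β α := by
  simp only [formInner, mul_comm]

theorem formInner_add_left (α α' β : V [⋀^Fin 4]→ₗ[ℝ] ℝ) :
    formInner (α + α') β = formInner α β + formInner α' β := by
  simp only [formInner, AlternatingMap.add_apply, add_mul, Finset.sum_add_distrib, mul_add]

theorem formInner_smul_left (c : ℝ) (α β : V [⋀^Fin 4]→ₗ[ℝ] ℝ) :
    formInner (c • α) β = c * formInner α β := by
  simp only [formInner, AlternatingMap.smul_apply, smul_eq_mul, mul_assoc, ← Finset.mul_sum]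
  rw [mul_left_comm]

theorem formInner_add_right (α β β' : V [⋀^Fin 4]→ₗ[ℝ] ℝ) :
    formInner α (β + β') = formInner α β + formInner α β' := by
  rw [formInner_comm, formInner_add_left, formInner_comm, formInner_comm β']

theorem formInner_smul_right (c : ℝ) (α β : V [⋀^Fin 4]→ₗ[ℝ] ℝ) :
    formInner α (c • β) = c * formInner α β := by
  rw [formInner_comm, formInner_smul_left, formInner_comm]

theorem formInner_wedgeTwo_left (β γ : V →ₗ[ℝ] V →ₗ[ℝ] ℝ) (η : V [⋀^Fin 4]→ₗ[ℝ] ℝ) :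
    formInner (wedgeTwo β γ) η = 1 / 4 * ∑ i : Fin 4 → Fin (Module.finrank ℝ V),
      β (stdOrthonormalBasis ℝ V (i 0)) (stdOrthonormalBasis ℝ V (i 1)) *
      γ (stdOrthonormalBasis ℝ V (i 2)) (stdOrthonormalBasis ℝ V (i 3)) *
      η fun k => stdOrthonormalBasis ℝ V (i k) := by
  set e := stdOrthonormalBasis ℝ V
  set S := ∑ i : Fin 4 → Fin (Module.finrank ℝ V),
    β (e (i 0)) (e (i 1)) * γ (e (i 2)) (e (i 3)) * η fun k => e (i k)
  -- As `η` is alternating, all permutations contribute the same amount to the pairing.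
  have perm_term (σ : Equiv.Perm (Fin 4)) : ∑ i : Fin 4 → Fin (Module.finrank ℝ V),
      (Equiv.Perm.sign σ : ℤ) * (β (e (i (σ 0))) (e (i (σ 1))) * γ (e (i (σ 2))) (e (i (σ 3)))) *
        η (fun k => e (i k)) = S := by
    rw [← (σ.arrowCongr (Equiv.refl (Fin (Module.finrank ℝ V)))).sum_comp]
    refine Finset.sum_congr rfl fun i _ => ?_
    have hη := η.map_perm (fun k => e (i (σ.symm k))) σ
    simp only [Function.comp_def, Equiv.symm_apply_apply] at hη
    simp only [Equiv.arrowCongr_apply, Function.comp_apply, Equiv.symm_apply_apply,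
      Equiv.coe_refl, id_eq, hη, Units.smul_def, zsmul_eq_mul]
    ring
  calc formInner (wedgeTwo β γ) η
      = 1 / 24 * (1 / 4 * ∑ σ : Equiv.Perm (Fin 4), ∑ i : Fin 4 → Fin (Module.finrank ℝ V),
          (Equiv.Perm.sign σ : ℤ) *
            (β (e (i (σ 0))) (e (i (σ 1))) * γ (e (i (σ 2))) (e (i (σ 3)))) *
              η fun k => e (i k)) := by
        simp only [formInner, wedgeTwo_apply, mul_assoc (1 / 4 : ℝ), Finset.sum_mul,
          ← Finset.mul_sum]
        rw [Finset.sum_comm]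
    _ = 1 / 4 * S := by
        simp only [perm_term, Finset.sum_const, Finset.card_univ, Fintype.card_perm,
          Fintype.card_fin, nsmul_eq_mul]
        norm_num [Nat.factorial]
        ring

end Bilinear

/-- The trace of a continuous endomorphism. -/
def endTrace : (V →L[ℝ] V) →ₗ[ℝ] ℝ :=
  (LinearMap.trace ℝ V).comp (ContinuousLinearMap.coeLM ℝ)

theorem endTrace_mul_comm (α β : V →L[ℝ] V) : endTrace (α * β) = endTrace (β * α) :=
  LinearMap.trace_mul_comm ℝ α.toLinearMap β.toLinearMap

theorem endTrace_eq_sum {ι : Type*} [Fintype ι] (e : OrthonormalBasis ι ℝ V) (α : V →L[ℝ] V) :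
    endTrace α = ∑ i, inner ℝ (e i) (α (e i)) :=
  LinearMap.trace_eq_sum_inner α.toLinearMap e

theorem endTrace_one [FiniteDimensional ℝ V] :
    endTrace (1 : V →L[ℝ] V) = Module.finrank ℝ V :=
  LinearMap.trace_one ℝ V

/-- The endomorphism `α` is skew-symmetric. This is stated without the adjoint, so that it makes
sense on spaces that are not complete. -/
def IsSkewEnd (α : V →L[ℝ] V) : Prop := ∀ u v, inner ℝ (α u) v = -inner ℝ u (α v)

/-- The 4-form `ω_α ∧ ω_α`. -/
def kahlerSq (α : V →L[ℝ] V) : V [⋀^Fin 4]→ₗ[ℝ] ℝ :=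
  wedgeTwo (kahlerForm α) (kahlerForm α)

theorem IsSkewEnd.kahlerSq_apply {α : V →L[ℝ] V} (hα : IsSkewEnd α) (v : Fin 4 → V) :
    kahlerSq α v =
      2 * (inner ℝ (α (v 0)) (v 1) * inner ℝ (α (v 2)) (v 3)
        - inner ℝ (α (v 0)) (v 2) * inner ℝ (α (v 1)) (v 3)
        + inner ℝ (α (v 0)) (v 3) * inner ℝ (α (v 1)) (v 2)) := by
  have swap (u w : V) : inner ℝ (α u) w = -inner ℝ (α w) u := by rw [hα, real_inner_comm]
  rw [kahlerSq, wedgeTwo_apply, sum_perm_fin_four (fun a b c d =>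
    kahlerForm α (v a) (v b) * kahlerForm α (v c) (v d))]
  simp only [kahlerForm, LinearMap.comp_apply, innerₗ_apply_apply, ContinuousLinearMap.coe_coe]
  rw [swap (v 1) (v 0), swap (v 2) (v 0), swap (v 3) (v 0), swap (v 2) (v 1), swap (v 3) (v 1),
    swap (v 3) (v 2)]
  ring

section Contraction

variable {ι : Type*} [Fintype ι] (e : OrthonormalBasis ι ℝ V) {α β : V →L[ℝ] V}

theorem IsSkewEnd.sum_inner_mul_inner (hα : IsSkewEnd α) (β : V →L[ℝ] V) :
    ∑ a, ∑ b, inner ℝ (α (e a)) (e b) * inner ℝ (β (e a)) (e b) = -endTrace (α * β) := by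
  simp only [endTrace_eq_sum e, real_inner_comm (e _) (β _), e.sum_inner_mul_inner,
    mul_apply_eq_comp, hα _ (β _), Finset.sum_neg_distrib]

theorem IsSkewEnd.sum_cross_inner (hα : IsSkewEnd α) (hβ : IsSkewEnd β) :
    ∑ a, ∑ b, ∑ c, ∑ d, inner ℝ (α (e a)) (e b) * inner ℝ (α (e c)) (e d) *
      (inner ℝ (β (e a)) (e c) * inner ℝ (β (e b)) (e d)) = endTrace (α * β * (α * β)) := by
  have contract_left (a d : ι) :
      ∑ b, inner ℝ (α (e a)) (e b) * inner ℝ (β (e b)) (e d) = inner ℝ (β (α (e a))) (e d) := by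
    simp only [hβ (e _), mul_neg, Finset.sum_neg_distrib, e.sum_inner_mul_inner, hβ (α _)]
  have contract_right (a d : ι) :
      ∑ c, inner ℝ (β (e a)) (e c) * inner ℝ (α (e c)) (e d) = inner ℝ (α (β (e a))) (e d) := by
    simp only [hα (e _), mul_neg, Finset.sum_neg_distrib, e.sum_inner_mul_inner, hα (β _)]
  calc _ = ∑ a, ∑ d, (∑ b, inner ℝ (α (e a)) (e b) * inner ℝ (β (e b)) (e d)) *
            ∑ c, inner ℝ (β (e a)) (e c) * inner ℝ (α (e c)) (e d) := by
        refine Finset.sum_congr rfl fun a _ => ?_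
        rw [Finset.sum_congr rfl fun b _ => Finset.sum_comm, Finset.sum_comm]
        simp only [Finset.sum_mul_sum]
        refine Finset.sum_congr rfl fun d _ => Finset.sum_congr rfl fun b _ =>
          Finset.sum_congr rfl fun c _ => ?_
        ring
    _ = ∑ a, inner ℝ (β (α (e a))) (α (β (e a))) := by
        simp only [contract_left, contract_right, real_inner_comm (e _) (α (β _)),
          e.sum_inner_mul_inner]
    _ = endTrace (α * β * (α * β)) := by
        simp only [endTrace_eq_sum e, mul_apply_eq_comp, hβ (α _), hα (e _), neg_neg]

end Contraction

theorem formInner_kahlerSq [FiniteDimensional ℝ V] {α β : V →L[ℝ] V} (hα : IsSkewEnd α)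
    (hβ : IsSkewEnd β) :
    formInner (kahlerSq α) (kahlerSq β) =
      1 / 2 * endTrace (α * β) ^ 2 - endTrace (α * β * (α * β)) := by
  set e := stdOrthonormalBasis ℝ V
  let A a b := inner ℝ (α (e a)) (e b)
  let B a b := inner ℝ (β (e a)) (e b)
  have hA (a b) : A a b = -A b a := by simp only [A, hα (e b), real_inner_comm (α _), neg_neg]
  have parallel : ∑ a, ∑ b, ∑ c, ∑ d, A a b * A c d * (B a b * B c d) = endTrace (α * β) ^ 2 := by
    rw [← neg_sq, ← hα.sum_inner_mul_inner e β, sq]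
    simp only [Finset.sum_mul, Finset.mul_sum]
    refine Finset.sum_congr rfl fun a _ => Finset.sum_congr rfl fun b _ =>
      Finset.sum_congr rfl fun c _ => Finset.sum_congr rfl fun d _ => ?_
    ring
  have crossed : ∑ a, ∑ b, ∑ c, ∑ d, A a b * A c d * (B a c * B b d) =
      endTrace (α * β * (α * β)) := hα.sum_cross_inner e hβ
  have crossed' : ∑ a, ∑ b, ∑ c, ∑ d, A a b * A c d * (B a d * B b c) =
      -endTrace (α * β * (α * β)) := by
    rw [← crossed]
    simp only [← Finset.sum_neg_distrib]
    refine Finset.sum_congr rfl fun a _ => Finset.sum_congr rfl fun b _ => ?_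
    rw [Finset.sum_comm]
    refine Finset.sum_congr rfl fun c _ => Finset.sum_congr rfl fun d _ => ?_
    rw [hA d c]
    ring
  rw [kahlerSq, formInner_wedgeTwo_left]
  calc _ = 1 / 4 * ∑ a, ∑ b, ∑ c, ∑ d,
            A a b * A c d * (2 * (B a b * B c d - B a c * B b d + B a d * B b c)) := by
        rw [← sum_fin_four_fun]
        simp only [hβ.kahlerSq_apply]
        rfl
    _ = 1 / 2 * (∑ a, ∑ b, ∑ c, ∑ d, A a b * A c d * (B a b * B c d) -
          ∑ a, ∑ b, ∑ c, ∑ d, A a b * A c d * (B a c * B b d) +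
          ∑ a, ∑ b, ∑ c, ∑ d, A a b * A c d * (B a d * B b c)) := by
        simp only [Finset.mul_sum, ← Finset.sum_add_distrib, ← Finset.sum_sub_distrib]
        refine Finset.sum_congr rfl fun a _ => Finset.sum_congr rfl fun b _ =>
          Finset.sum_congr rfl fun c _ => Finset.sum_congr rfl fun d _ => ?_
        ring
    _ = _ := by rw [parallel, crossed, crossed']; ring

theorem formInner_hkForm [FiniteDimensional ℝ V] (J J' : Fin 3 → V →L[ℝ] V) :
    formInner (hkForm J) (hkForm J') =
      1 / 36 * ∑ i, ∑ j, formInner (kahlerSq (J i)) (kahlerSq (J' j)) := by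
  simp only [hkForm, kahlerSq, Fin.sum_univ_three, formInner_smul_left, formInner_smul_right,
    formInner_add_left, formInner_add_right]
  ring

end FormInner

section EndInner

variable {V : Type*} [NormedAddCommGroup V] [InnerProductSpace ℝ V]

/-- The inner product `-tr(α β) / 8` on skew-symmetric endomorphisms. The factor is chosen so that
orthogonal complex structures of an 8-dimensional space are unit vectors. -/
def endInner : (V →L[ℝ] V) →ₗ[ℝ] (V →L[ℝ] V) →ₗ[ℝ] ℝ :=
  LinearMap.mk₂ ℝ (fun α β => -endTrace (α * β) / 8)
    (fun α α' β => by rw [add_mul, map_add]; ring)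
    (fun c α β => by rw [smul_mul_assoc, map_smul, smul_eq_mul, smul_eq_mul]; ring)
    (fun α β β' => by rw [mul_add, map_add]; ring)
    (fun c α β => by rw [mul_smul_comm, map_smul, smul_eq_mul, smul_eq_mul]; ring)

theorem endInner_apply (α β : V →L[ℝ] V) : endInner α β = -endTrace (α * β) / 8 := rfl

theorem endTrace_mul (α β : V →L[ℝ] V) : endTrace (α * β) = -8 * endInner α β := by
  rw [endInner_apply]; ring

theorem endInner_comm (α β : V →L[ℝ] V) : endInner α β = endInner β α := by
  rw [endInner_apply, endInner_apply, endTrace_mul_comm]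

theorem endInner_eq_zero_of_anticomm {α β : V →L[ℝ] V} (h : α * β = -(β * α)) :
    endInner α β = 0 := by
  have neg_self : endInner α β = -endInner α β := by
    conv_lhs => rw [endInner_apply, h, map_neg, ← endTrace_mul_comm, neg_div, ← endInner_apply]
  linarith

namespace IsSkewEnd

variable {α β : V →L[ℝ] V}

theorem endInner_self_eq_sum {ι : Type*} [Fintype ι] (hα : IsSkewEnd α)
    (e : OrthonormalBasis ι ℝ V) : endInner α α = (∑ i, ‖α (e i)‖ ^ 2) / 8 := by
  simp only [endInner_apply, endTrace_eq_sum e, mul_apply_eq_comp, ← Finset.sum_neg_distrib,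
    ← hα _ (α _), real_inner_self_eq_norm_sq]

theorem endInner_self_nonneg [FiniteDimensional ℝ V] (hα : IsSkewEnd α) : 0 ≤ endInner α α := by
  rw [hα.endInner_self_eq_sum (stdOrthonormalBasis ℝ V)]
  positivity

theorem eq_zero_of_endInner_self [FiniteDimensional ℝ V] (hα : IsSkewEnd α)
    (h : endInner α α = 0) : α = 0 := by
  let e := stdOrthonormalBasis ℝ V
  rw [hα.endInner_self_eq_sum e, div_eq_zero_iff, or_iff_left (by norm_num),
    Finset.sum_eq_zero_iff_of_nonneg fun i _ => by positivity] at h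
  refine ContinuousLinearMap.coe_injective (e.toBasis.ext fun i => ?_)
  simpa using h i (Finset.mem_univ i)

theorem add (hα : IsSkewEnd α) (hβ : IsSkewEnd β) : IsSkewEnd (α + β) := fun u v => by
  simp only [add_apply, inner_add_left, inner_add_right, hα u v, hβ u v, neg_add]

theorem smul (hα : IsSkewEnd α) (c : ℝ) : IsSkewEnd (c • α) := fun u v => by
  simp only [smul_apply, real_inner_smul_left, real_inner_smul_right, hα u v, mul_neg]

theorem sub (hα : IsSkewEnd α) (hβ : IsSkewEnd β) : IsSkewEnd (α - β) := fun u v => by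
  simp only [sub_apply, inner_sub_left, inner_sub_right, hα u v, hβ u v, neg_sub_neg, neg_sub]

theorem mul_of_anticomm (hα : IsSkewEnd α) (hβ : IsSkewEnd β) (h : α * β = -(β * α)) :
    IsSkewEnd (α * β) := fun u v => by
  rw [mul_apply_eq_comp, hα, hβ, neg_neg, ← mul_apply_eq_comp, h, neg_apply, inner_neg_right,
    neg_neg]

end IsSkewEnd

/-- `(I, J)` is a pair of anticommuting orthogonal complex structures, so that `I`, `J` and `I J`
generate a copy of the quaternions. -/
structure IsQuatPair (I J : V →L[ℝ] V) : Prop where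
  skew_left : IsSkewEnd I
  skew_right : IsSkewEnd J
  sq_left : I * I = -1
  sq_right : J * J = -1
  anticomm : I * J = -(J * I)

namespace IsQuatPair

variable {I J : V →L[ℝ] V}

theorem symm (h : IsQuatPair I J) : IsQuatPair J I where
  skew_left := h.skew_right
  skew_right := h.skew_left
  sq_left := h.sq_right
  sq_right := h.sq_left
  anticomm := by rw [h.anticomm, neg_neg]

theorem skew_mul (h : IsQuatPair I J) : IsSkewEnd (I * J) :=
  h.skew_left.mul_of_anticomm h.skew_right h.anticomm

theorem mul_mul_left (h : IsQuatPair I J) : I * (I * J) = -J := by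
  rw [← mul_assoc, h.sq_left, neg_one_mul]

theorem mul_mul_right (h : IsQuatPair I J) : I * J * J = -I := by
  rw [mul_assoc, h.sq_right, mul_neg_one]

theorem rotate (h : IsQuatPair I J) : IsQuatPair J (I * J) where
  skew_left := h.skew_right
  skew_right := h.skew_mul
  sq_left := h.sq_right
  sq_right := by
    rw [mul_assoc, ← mul_assoc J, h.symm.anticomm, neg_mul, mul_neg, h.mul_mul_right, mul_neg,
      neg_neg, h.sq_left]
  anticomm := by rw [← mul_assoc, h.symm.anticomm, neg_mul]

theorem pair_mul (h : IsQuatPair I J) : IsQuatPair I (I * J) where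
  skew_left := h.skew_left
  skew_right := h.skew_mul
  sq_left := h.sq_left
  sq_right := h.rotate.sq_right
  anticomm := by
    rw [h.mul_mul_left, h.anticomm, neg_mul, mul_assoc, h.sq_left, mul_neg_one, neg_neg]

end IsQuatPair

section CommonStructure

variable [FiniteDimensional ℝ V] {I J J' : V →L[ℝ] V}

theorem endTrace_one_of_finrank (hV : Module.finrank ℝ V = 8) :
    endTrace (1 : V →L[ℝ] V) = 8 := by
  rw [endTrace_one, hV, Nat.cast_ofNat]

theorem endInner_self_of_sq (hV : Module.finrank ℝ V = 8) (hJ : J * J = -1) :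
    endInner J J = 1 := by
  rw [endInner_apply, hJ, map_neg, endTrace_one_of_finrank hV]
  norm_num

theorem formInner_kahlerSq_self_of_sq (hV : Module.finrank ℝ V = 8) (skew : IsSkewEnd J)
    (hJ : J * J = -1) : formInner (kahlerSq J) (kahlerSq J) = 24 := by
  rw [formInner_kahlerSq skew skew, hJ, neg_mul_neg, one_mul, map_neg, endTrace_one_of_finrank hV]
  norm_num

theorem IsQuatPair.formInner_kahlerSq (h : IsQuatPair I J) (hV : Module.finrank ℝ V = 8) :
    formInner (kahlerSq I) (kahlerSq J) = 8 := by
  rw [_root_.formInner_kahlerSq h.skew_left h.skew_right, endTrace_mul,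
    endInner_eq_zero_of_anticomm h.anticomm, h.rotate.sq_right, map_neg,
    endTrace_one_of_finrank hV]
  norm_num

theorem formInner_kahlerSq_add_of_common (h : IsQuatPair I J) (h' : IsQuatPair I J') :
    formInner (kahlerSq J) (kahlerSq J') + formInner (kahlerSq J) (kahlerSq (I * J')) =
      32 * (endInner J J' ^ 2 + endInner J (I * J') ^ 2) := by
  have commute : I * (J * J') = J * J' * I := by
    rw [← mul_assoc, h.anticomm, neg_mul, mul_assoc, h'.anticomm, mul_neg, neg_neg, mul_assoc]
  have mul_eq : J * (I * J') = -(I * (J * J')) := by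
    rw [← mul_assoc, h.symm.anticomm, neg_mul, mul_assoc]
  have sq_eq : J * (I * J') * (J * (I * J')) = -(J * J' * (J * J')) := by
    rw [mul_eq, neg_mul_neg, mul_assoc, ← mul_assoc (J * J'), ← commute, mul_assoc I (J * J'),
      ← mul_assoc I I, h.sq_left, neg_one_mul]
  rw [formInner_kahlerSq h.skew_right h'.skew_right, formInner_kahlerSq h.skew_right h'.skew_mul,
    sq_eq, map_neg, endTrace_mul J J', endTrace_mul J (I * J')]
  ring

theorem formInner_hkForm_of_common (hV : Module.finrank ℝ V = 8) (h : IsQuatPair I J)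
    (h' : IsQuatPair I J') :
    formInner (hkForm ![I, J, I * J]) (hkForm ![I, J', I * J']) =
      (14 + 16 * (endInner J J' ^ 2 + endInner J (I * J') ^ 2)) / 9 := by
  have mul_right : I * J * J' = -(J * (I * J')) := by
    rw [h.anticomm, neg_mul, mul_assoc]
  have mul_mul : I * J * (I * J') = J * J' := by
    rw [h.anticomm, neg_mul, mul_assoc, h'.mul_mul_left, mul_neg, neg_neg]
  have inner_right : endInner (I * J) J' = -endInner J (I * J') := by
    simp only [endInner_apply, mul_right, map_neg]; ring
  have inner_mul_mul : endInner (I * J) (I * J') = endInner J J' := by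
    simp only [endInner_apply, mul_mul]
  have first_row := formInner_kahlerSq_add_of_common h h'
  have second_row := formInner_kahlerSq_add_of_common h.pair_mul h'
  rw [inner_right, inner_mul_mul] at second_row
  rw [formInner_hkForm]
  simp only [Fin.sum_univ_three, Matrix.cons_val_zero, Matrix.cons_val_one, Matrix.cons_val_two,
    Matrix.head_cons, Matrix.tail_cons]
  rw [formInner_kahlerSq_self_of_sq hV h.skew_left h.sq_left, h'.formInner_kahlerSq hV,
    h'.pair_mul.formInner_kahlerSq hV, h.symm.formInner_kahlerSq hV,
    h.pair_mul.symm.formInner_kahlerSq hV]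
  linear_combination (first_row + second_row) / 36

end CommonStructure

end EndInner

section Orientation

variable {V : Type*} [NormedAddCommGroup V] [InnerProductSpace ℝ V]

-- `T` is complex linear for the complex structure `J`, and its real determinant is the squared
-- modulus of its complex determinant.
theorem det_pos_of_commute_complex {V : Type*} [AddCommGroup V] [Module ℝ V]
    [FiniteDimensional ℝ V] {J : Module.End ℝ V} (hJ : J * J = -1) {T : Module.End ℝ V}
    (hT : T * J = J * T) (hdet : LinearMap.det T ≠ 0) : 0 < LinearMap.det T := by
  let φ : ℂ →ₐ[ℝ] Module.End ℝ V := Complex.lift ⟨J, hJ⟩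
  let _ : Module ℂ V := Module.compHom V φ.toRingHom
  have complex_smul (z : ℂ) (v : V) : z • v = z.re • v + z.im • J v := by
    change φ z v = _
    simp [φ, Complex.lift_apply, Complex.liftAux_apply, Algebra.algebraMap_eq_smul_one]
  have : IsScalarTower ℝ ℂ V := ⟨fun r z v => by
    simp only [complex_smul, Complex.smul_re, Complex.smul_im, smul_eq_mul, mul_smul, smul_add]⟩
  have commute (v : V) : T (J v) = J (T v) := LinearMap.congr_fun hT v
  let T' : V →ₗ[ℂ] V :=
    { toFun := T
      map_add' := T.map_add
      map_smul' := fun z v => by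
        simp only [complex_smul, map_add, map_smul, commute, RingHom.id_apply] }
  have restrict : T = T'.restrictScalars ℝ := rfl
  have : Module.Finite ℂ V := Module.Finite.right ℝ ℂ V
  rw [restrict, LinearMap.det_restrictScalars, Algebra.norm_complex_apply] at hdet ⊢
  exact (Complex.normSq_nonneg _).lt_of_ne' hdet

/-- The basis `b` has the form `(v₁, J v₁, v₂, J v₂, v₃, J v₃, v₄, J v₄)`. -/
def IsComplexBasis (J : V →L[ℝ] V) (b : Module.Basis (Fin 8) ℝ V) : Prop :=
  b 1 = J (b 0) ∧ b 3 = J (b 2) ∧ b 5 = J (b 4) ∧ b 7 = J (b 6)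

theorem IsComplexBasis.orientation_eq {J : V →L[ℝ] V} (hJ : J * J = -1)
    {b b' : Module.Basis (Fin 8) ℝ V} (h : IsComplexBasis J b) (h' : IsComplexBasis J b') :
    b'.orientation = b.orientation := by
  have : FiniteDimensional ℝ V := b.finiteDimensional_of_finite
  have sq (v : V) : J (J v) = -v := DFunLike.congr_fun hJ v
  let T : V ≃ₗ[ℝ] V := b.equiv b' (Equiv.refl _)
  have T_basis (i : Fin 8) : T (b i) = b' i := by simp [T]
  have commute_pair {k l : Fin 8} (hb : b l = J (b k)) (hb' : b' l = J (b' k)) :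
      T (J (b k)) = J (T (b k)) ∧ T (J (b l)) = J (T (b l)) := by
    rw [← hb, T_basis, T_basis, hb, sq, map_neg, T_basis, hb', sq]
    exact ⟨rfl, rfl⟩
  have commute : T.toLinearMap * J.toLinearMap = J.toLinearMap * T.toLinearMap := by
    refine b.ext fun i => ?_
    fin_cases i
    exacts [(commute_pair h.1 h'.1).1, (commute_pair h.1 h'.1).2,
      (commute_pair h.2.1 h'.2.1).1, (commute_pair h.2.1 h'.2.1).2,
      (commute_pair h.2.2.1 h'.2.2.1).1, (commute_pair h.2.2.1 h'.2.2.1).2,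
      (commute_pair h.2.2.2 h'.2.2.2).1, (commute_pair h.2.2.2 h'.2.2.2).2]
  have map_eq : b.map T = b' := Module.Basis.eq_of_apply_eq fun i => by simp [T_basis]
  rw [← map_eq, b.orientation_comp_linearEquiv_eq_iff_det_pos]
  exact det_pos_of_commute_complex (J := J.toLinearMap) (LinearMap.ext sq) commute
    (LinearEquiv.isUnit_det' T).ne_zero

namespace IsPosOrthComplexStructure

variable {o : Orientation ℝ V (Fin 8)} {J : V →L[ℝ] V}

theorem of_basis (skew : IsSkewEnd J) (hJ : J * J = -1) {b : Module.Basis (Fin 8) ℝ V}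
    (hb : IsComplexBasis J b) (ho : b.orientation = o) : IsPosOrthComplexStructure o J where
  isometry u v := by
    rw [skew, ← mul_apply_eq_comp, hJ, neg_apply, inner_neg_right, neg_neg, one_apply_eq_self]
  sq v := DFunLike.congr_fun hJ v
  positive _ h₀ h₂ h₄ h₆ := (IsComplexBasis.orientation_eq hJ hb ⟨h₀, h₂, h₄, h₆⟩).trans ho

theorem mul_self (h : IsPosOrthComplexStructure o J) : J * J = -1 :=
  ContinuousLinearMap.ext h.sq

theorem skew (h : IsPosOrthComplexStructure o J) : IsSkewEnd J := fun u v => by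
  rw [← h.isometry u (J v), h.sq, inner_neg_right, neg_neg]

end IsPosOrthComplexStructure

namespace IsHKTriple

variable {o : Orientation ℝ V (Fin 8)} {J : Fin 3 → V →L[ℝ] V}

theorem isQuatPair (h : IsHKTriple o J) : IsQuatPair (J 0) (J 1) where
  skew_left := (h.complex 0).skew
  skew_right := (h.complex 1).skew
  sq_left := (h.complex 0).mul_self
  sq_right := (h.complex 1).mul_self
  anticomm := ContinuousLinearMap.ext h.anticomm

theorem eq_mul (h : IsHKTriple o J) : J 2 = J 0 * J 1 := ContinuousLinearMap.ext h.mul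

theorem eq_cons (h : IsHKTriple o J) : J = ![J 0, J 1, J 0 * J 1] := by
  ext1 i; fin_cases i
  exacts [rfl, rfl, h.eq_mul]

end IsHKTriple

theorem IsSkewEnd.inner_apply_self {α : V →L[ℝ] V} (hα : IsSkewEnd α) (v : V) :
    inner ℝ v (α v) = (0 : ℝ) := by
  linarith [hα v v, real_inner_comm v (α v)]

theorem exists_unit_mem_orthogonal {S : Submodule ℝ V} [S.HasOrthogonalProjection]
    (hS : S ≠ ⊤) : ∃ u ∈ Sᗮ, ‖u‖ = 1 := by
  obtain ⟨w, w_mem, w_ne⟩ :=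
    Submodule.exists_mem_ne_zero_of_ne_bot (mt Submodule.orthogonal_eq_bot_iff.1 hS)
  exact ⟨‖w‖⁻¹ • w, Submodule.smul_mem _ _ w_mem, norm_smul_inv_norm (𝕜 := ℝ) w_ne⟩

/-- The orbit of a vector under the basic quaternions `1, I, J, I J`. -/
def quatOrbit (I J : V →L[ℝ] V) (v : V) : Fin 4 → V := ![v, I v, J v, I (J v)]

namespace IsQuatPair

variable {I J : V →L[ℝ] V}

theorem inner_quatOrbit (h : IsQuatPair I J) {x y : V} (hI : inner ℝ x (I y) = (0 : ℝ))
    (hJ : inner ℝ x (J y) = (0 : ℝ)) (hK : inner ℝ x (I (J y)) = (0 : ℝ)) (i j : Fin 4) :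
    inner ℝ (quatOrbit I J x i) (quatOrbit I J y j) = if i = j then inner ℝ x y else 0 := by
  have sq_left (v : V) : I (I v) = -v := DFunLike.congr_fun h.sq_left v
  have sq_right (v : V) : J (J v) = -v := DFunLike.congr_fun h.sq_right v
  have anticomm (v : V) : J (I v) = -I (J v) := DFunLike.congr_fun h.symm.anticomm v
  fin_cases i <;> fin_cases j <;>
    simp [quatOrbit, h.skew_left _ _, h.skew_right _ _, sq_left, sq_right, anticomm, hI, hJ, hK]

theorem inner_quatOrbit_self (h : IsQuatPair I J) {x : V} (hx : ‖x‖ = 1) (i j : Fin 4) :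
    inner ℝ (quatOrbit I J x i) (quatOrbit I J x j) = if i = j then (1 : ℝ) else 0 := by
  rw [h.inner_quatOrbit (h.skew_left.inner_apply_self x) (h.skew_right.inner_apply_self x)
    (h.skew_mul.inner_apply_self x), real_inner_self_eq_norm_sq, hx, one_pow]

theorem inner_quatOrbit_eq_zero (h : IsQuatPair I J) {x y : V}
    (hy : ∀ i, inner ℝ (quatOrbit I J x i) y = (0 : ℝ)) (i j : Fin 4) :
    inner ℝ (quatOrbit I J x i) (quatOrbit I J y j) = (0 : ℝ) := by
  have hI : inner ℝ x (I y) = (0 : ℝ) := by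
    rw [← neg_eq_zero, ← h.skew_left]; exact hy 1
  have hJ : inner ℝ x (J y) = (0 : ℝ) := by
    rw [← neg_eq_zero, ← h.skew_right]; exact hy 2
  have hK : inner ℝ x (I (J y)) = (0 : ℝ) := by
    rw [← mul_apply_eq_comp, ← neg_eq_zero, ← h.skew_mul]; exact hy 3
  have hxy : inner ℝ x y = (0 : ℝ) := hy 0
  rw [h.inner_quatOrbit hI hJ hK, hxy, ite_self]

theorem orthonormal_quatOrbit (h : IsQuatPair I J) {v u : V} (hv : ‖v‖ = 1) (hu : ‖u‖ = 1)
    (orth : ∀ i, inner ℝ (quatOrbit I J v i) u = (0 : ℝ)) :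
    Orthonormal ℝ (fun p : Fin 2 × Fin 4 => quatOrbit I J (![v, u] p.1) p.2) := by
  rw [orthonormal_iff_ite]
  rintro ⟨a, i⟩ ⟨b, j⟩
  fin_cases a <;> fin_cases b
  · simpa using h.inner_quatOrbit_self hv i j
  · simpa using h.inner_quatOrbit_eq_zero orth i j
  · simpa [real_inner_comm] using h.inner_quatOrbit_eq_zero orth j i
  · simpa using h.inner_quatOrbit_self hu i j

theorem exists_orthonormalBasis [FiniteDimensional ℝ V] (hV : Module.finrank ℝ V = 8)
    (h : IsQuatPair I J) {v : V} (hv : ‖v‖ = 1) :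
    ∃ (b : OrthonormalBasis (Fin 8) ℝ V) (u : V),
      ⇑b = ![v, I v, J v, I (J v), u, I u, J u, I (J u)] := by
  have orbit_ne_top : Submodule.span ℝ (Set.range (quatOrbit I J v)) ≠ ⊤ := fun span_eq => by
    have := finrank_range_le_card (R := ℝ) (quatOrbit I J v)
    rw [Set.finrank, span_eq, finrank_top, hV, Fintype.card_fin] at this
    omega
  obtain ⟨u, u_mem, hu⟩ := exists_unit_mem_orthogonal orbit_ne_top
  have orth (i : Fin 4) : inner ℝ (quatOrbit I J v i) u = (0 : ℝ) :=
    (Submodule.mem_orthogonal _ _).1 u_mem _ (Submodule.subset_span ⟨i, rfl⟩)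
  have ortho := (h.orthonormal_quatOrbit hv hu orth).comp
    (finProdFinEquiv (m := 2) (n := 4)).symm (Equiv.injective _)
  have card_eq : Fintype.card (Fin (2 * 4)) = Module.finrank ℝ V := by rw [hV, Fintype.card_fin]
  have coe_basis := coe_basisOfOrthonormalOfCardEqFinrank ortho card_eq
  refine ⟨(basisOfOrthonormalOfCardEqFinrank ortho card_eq).toOrthonormalBasis
    (by rwa [coe_basis]), u, ?_⟩
  rw [Module.Basis.coe_toOrthonormalBasis, coe_basis]
  ext1 i
  fin_cases i <;> rfl

end IsQuatPair

theorem orientation_reindex_of_sign_eq_one {ι R M : Type*} [Fintype ι] [DecidableEq ι]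
    [CommRing R] [LinearOrder R] [IsStrictOrderedRing R] [AddCommGroup M] [Module R M]
    (b : Module.Basis ι R M) {σ : Equiv.Perm ι} (hσ : Equiv.Perm.sign σ = 1) :
    (b.reindex σ).orientation = b.orientation := by
  symm
  rw [b.orientation_eq_iff_det_pos, b.coe_reindex, AlternatingMap.map_perm, Equiv.Perm.sign_symm,
    hσ, one_smul, b.det_self]
  exact one_pos

theorem IsPosOrthComplexStructure.of_isQuatPair [FiniteDimensional ℝ V]
    (hV : Module.finrank ℝ V = 8) {o : Orientation ℝ V (Fin 8)} {I J : V →L[ℝ] V}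
    (hI : IsPosOrthComplexStructure o I) (h : IsQuatPair I J) :
    IsPosOrthComplexStructure o J := by
  have : Nontrivial V := Module.nontrivial_of_finrank_pos (R := ℝ) (by omega)
  obtain ⟨v, hv⟩ := exists_norm_eq V (zero_le_one (α := ℝ))
  obtain ⟨b, u, hb⟩ := h.exists_orthonormalBasis hV hv
  have orientation_b : b.toBasis.orientation = o :=
    hI.positive b.toBasis (by simp [hb]) (by simp [hb]) (by simp [hb]) (by simp [hb])
  -- An even permutation turns `b` into `(v, J v, I J v, I v, u, J u, I J u, I u)`.
  let τ : Equiv.Perm (Fin 8) := c[1, 3, 2] * c[5, 7, 6]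
  have coe_τ : ⇑τ.symm = ![0, 2, 3, 1, 4, 6, 7, 5] := by decide
  have sq (v : V) : J (J v) = -v := DFunLike.congr_fun h.sq_right v
  have anticomm (v : V) : J (I v) = -I (J v) := DFunLike.congr_fun h.symm.anticomm v
  refine IsPosOrthComplexStructure.of_basis h.skew_right h.sq_right (b := b.toBasis.reindex τ)
    ?_ (by rw [orientation_reindex_of_sign_eq_one _ (by decide), orientation_b])
  refine ⟨?_, ?_, ?_, ?_⟩ <;> simp [coe_τ, hb, sq, anticomm]

theorem IsHKTriple.of_isQuatPair [FiniteDimensional ℝ V] (hV : Module.finrank ℝ V = 8)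
    {o : Orientation ℝ V (Fin 8)} {I J : V →L[ℝ] V} (hI : IsPosOrthComplexStructure o I)
    (h : IsQuatPair I J) : IsHKTriple o ![I, J, I * J] where
  complex i := by
    fin_cases i
    exacts [hI, hI.of_isQuatPair hV h, hI.of_isQuatPair hV h.pair_mul]
  anticomm := DFunLike.congr_fun h.anticomm
  mul _ := rfl

end Orientation

section SelfDual

theorem det_fin_four {R : Type*} [CommRing R] (A : Matrix (Fin 4) (Fin 4) R) :
    A.det =
      A 0 0 * A 1 1 * A 2 2 * A 3 3 - A 0 0 * A 1 1 * A 3 2 * A 2 3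
      - A 0 0 * A 2 1 * A 1 2 * A 3 3 + A 0 0 * A 2 1 * A 3 2 * A 1 3
      + A 0 0 * A 3 1 * A 1 2 * A 2 3 - A 0 0 * A 3 1 * A 2 2 * A 1 3
      - A 1 0 * A 0 1 * A 2 2 * A 3 3 + A 1 0 * A 0 1 * A 3 2 * A 2 3
      + A 1 0 * A 2 1 * A 0 2 * A 3 3 - A 1 0 * A 2 1 * A 3 2 * A 0 3
      - A 1 0 * A 3 1 * A 0 2 * A 2 3 + A 1 0 * A 3 1 * A 2 2 * A 0 3
      + A 2 0 * A 0 1 * A 1 2 * A 3 3 - A 2 0 * A 0 1 * A 3 2 * A 1 3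
      - A 2 0 * A 1 1 * A 0 2 * A 3 3 + A 2 0 * A 1 1 * A 3 2 * A 0 3
      + A 2 0 * A 3 1 * A 0 2 * A 1 3 - A 2 0 * A 3 1 * A 1 2 * A 0 3
      - A 3 0 * A 0 1 * A 1 2 * A 2 3 + A 3 0 * A 0 1 * A 2 2 * A 1 3
      + A 3 0 * A 1 1 * A 0 2 * A 2 3 - A 3 0 * A 1 1 * A 2 2 * A 0 3
      - A 3 0 * A 2 1 * A 0 2 * A 1 3 + A 3 0 * A 2 1 * A 1 2 * A 0 3 := by
  rw [Matrix.det_apply']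
  simp only [Fin.prod_univ_four]
  exact sum_perm_fin_four (fun a b c d => A a 0 * A b 1 * A c 2 * A d 3)

theorem det_append_basis {R M : Type*} [CommRing R] [AddCommGroup M] [Module R M] {m n : ℕ}
    (b : Module.Basis (Fin (m + n)) R M) (u : Fin m → M) :
    b.det (Fin.append u fun j => b (Fin.natAdd m j)) =
      (Matrix.of fun i j => b.repr (u j) (Fin.castAdd n i)).det := by
  rw [Module.Basis.det_apply, ← Matrix.det_reindex_self finSumFinEquiv.symm]
  have blocks : Matrix.reindex finSumFinEquiv.symm finSumFinEquiv.symm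
      (b.toMatrix (Fin.append u fun j => b (Fin.natAdd m j))) =
      Matrix.fromBlocks (Matrix.of fun i j => b.repr (u j) (Fin.castAdd n i)) 0
        (Matrix.of fun i j => b.repr (u j) (Fin.natAdd m i)) 1 := by
    ext i j
    rcases i with i | i <;> rcases j with j | j <;>
      simp [Module.Basis.toMatrix_apply, Finsupp.single_apply, Matrix.one_apply, Fin.ext_iff,
        eq_comm]
    omega
  rw [blocks, Matrix.det_fromBlocks_zero₁₂, Matrix.det_one, mul_one]

theorem det_append_basis_perm {R M : Type*} [CommRing R] [AddCommGroup M] [Module R M]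
    (b : Module.Basis (Fin 8) R M) {σ : Equiv.Perm (Fin 8)} (hσ : Equiv.Perm.sign σ = 1)
    (x : Fin 4 → M) :
    b.det ![b (σ 4), b (σ 5), b (σ 6), b (σ 7), x 0, x 1, x 2, x 3] =
      (Matrix.of fun i j => b.repr (x j) (σ (Fin.castAdd 4 i))).det := by
  let τ : Equiv.Perm (Fin 8) := c[0, 4] * c[1, 5] * c[2, 6] * c[3, 7]
  have coe_τ : ⇑τ = ![4, 5, 6, 7, 0, 1, 2, 3] := by decide
  let y : Fin 8 → M := Fin.append x fun j : Fin 4 => b (σ (Fin.natAdd 4 j))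
  have swap_blocks : ![b (σ 4), b (σ 5), b (σ 6), b (σ 7), x 0, x 1, x 2, x 3] = y ∘ τ := by
    ext1 i
    rw [Function.comp_apply, coe_τ]
    fin_cases i <;> rfl
  have det_reindex : (b.reindex σ.symm).det y = b.det y := by
    rw [Module.Basis.det_reindex, AlternatingMap.map_perm, Equiv.Perm.sign_symm, hσ, one_smul]
  rw [swap_blocks, AlternatingMap.map_perm, show Equiv.Perm.sign τ = 1 by decide, one_smul,
    ← det_reindex]
  have det_eq := det_append_basis (m := 4) (n := 4) (b.reindex σ.symm) x
  simp only [Module.Basis.reindex_apply, Module.Basis.repr_reindex_apply, Equiv.symm_symm]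
    at det_eq
  exact det_eq

section Contraction

variable {V : Type*} [NormedAddCommGroup V] [InnerProductSpace ℝ V] {n : ℕ}

theorem sum_apply_self_eq {N ι κ : Type*} [AddCommGroup N] [Module ℝ N] [Fintype ι] [Fintype κ]
    (b : OrthonormalBasis ι ℝ V) (e : OrthonormalBasis κ ℝ V) (ψ : V →ₗ[ℝ] V →ₗ[ℝ] N) :
    ∑ k, ψ (b k) (b k) = ∑ m, ψ (e m) (e m) := by
  calc ∑ k, ψ (b k) (b k) = ∑ k, ∑ m, ψ (e m) ((inner ℝ (b k) (e m) : ℝ) • b k) := by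
        refine Finset.sum_congr rfl fun k _ => ?_
        conv_lhs => enter [1, 2]; rw [← e.sum_repr' (b k)]
        simp only [map_sum, map_smul, LinearMap.sum_apply, LinearMap.smul_apply,
          real_inner_comm (b k)]
    _ = ∑ m, ψ (e m) (e m) := by
        rw [Finset.sum_comm]
        simp only [← map_sum, b.sum_repr']

/-- The interior product of forms with the bivector `u ∧ v`. -/
def interiorTwo (u v : V) : V [⋀^Fin (n + 2)]→ₗ[ℝ] ℝ →ₗ[ℝ] V [⋀^Fin n]→ₗ[ℝ] ℝ :=
  LinearMap.applyₗ v ∘ₗ AlternatingMap.curryLeftLinearMap ∘ₗ LinearMap.applyₗ u ∘ₗ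
    AlternatingMap.curryLeftLinearMap

theorem interiorTwo_apply (u v : V) (η : V [⋀^Fin (n + 2)]→ₗ[ℝ] ℝ) :
    interiorTwo u v η = (η.curryLeft u).curryLeft v := rfl

theorem curryLeft_swap (u v : V) (η : V [⋀^Fin (n + 2)]→ₗ[ℝ] ℝ) :
    (η.curryLeft v).curryLeft u = -(η.curryLeft u).curryLeft v := by
  let ψ : V →ₗ[ℝ] V →ₗ[ℝ] V [⋀^Fin n]→ₗ[ℝ] ℝ :=
    AlternatingMap.curryLeftLinearMap ∘ₗ η.curryLeft
  have alt : ψ.IsAlt := η.curryLeft_same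
  exact (alt.neg u v).symm

theorem interiorTwo_neg_swap (u v : V) :
    (interiorTwo v (-u) : V [⋀^Fin (n + 2)]→ₗ[ℝ] ℝ →ₗ[ℝ] _) = interiorTwo u v := by
  ext1 η
  rw [interiorTwo_apply, map_neg, curryLeft_swap, neg_neg, interiorTwo_apply]

theorem interiorTwo_curryLeft (u v w : V) (η : V [⋀^Fin (n + 3)]→ₗ[ℝ] ℝ) :
    interiorTwo u v (η.curryLeft w) = (interiorTwo u v η).curryLeft w := by
  calc ((η.curryLeft w).curryLeft u).curryLeft v
      = (-(η.curryLeft u).curryLeft w).curryLeft v :=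
        congrArg (fun ζ => ζ.curryLeft v) (curryLeft_swap u w η)
    _ = ((η.curryLeft u).curryLeft v).curryLeft w :=
        neg_eq_iff_eq_neg.2 (curryLeft_swap v w (η.curryLeft u))

theorem interiorTwo_comm (a b c d : V) (η : V [⋀^Fin (n + 4)]→ₗ[ℝ] ℝ) :
    interiorTwo a b (interiorTwo c d η) = interiorTwo c d (interiorTwo a b η) := by
  calc interiorTwo a b ((η.curryLeft c).curryLeft d)
      = (interiorTwo a b (η.curryLeft c)).curryLeft d := interiorTwo_curryLeft a b d _
    _ = interiorTwo c d (interiorTwo a b η) := by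
        rw [interiorTwo_curryLeft a b c η]
        rfl

theorem interiorTwo_interiorTwo_self (u v : V) (η : V [⋀^Fin (n + 4)]→ₗ[ℝ] ℝ) :
    interiorTwo u v (interiorTwo u v η) = 0 := by
  have repeated : interiorTwo u v (η.curryLeft u) = 0 :=
    congrArg (fun ζ => ζ.curryLeft v) (η.curryLeft_same u)
  calc interiorTwo u v (interiorTwo u v η)
      = (interiorTwo u v (η.curryLeft u)).curryLeft v := interiorTwo_curryLeft u v v _
    _ = 0 := by rw [repeated, AlternatingMap.curryLeft_zero, LinearMap.zero_apply]

/-- The contraction `η ↦ ∑ k, ι_{J e_k} ι_{e_k} η` of forms with the bivector dual to `ω_J`; it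
does not depend on the orthonormal basis `e`. -/
def kahlerContraction [FiniteDimensional ℝ V] (J : V →L[ℝ] V) :
    V [⋀^Fin (n + 2)]→ₗ[ℝ] ℝ →ₗ[ℝ] V [⋀^Fin n]→ₗ[ℝ] ℝ :=
  ∑ k, interiorTwo (stdOrthonormalBasis ℝ V k) (J (stdOrthonormalBasis ℝ V k))

theorem kahlerContraction_eq_sum [FiniteDimensional ℝ V] {ι : Type*} [Fintype ι]
    (e : OrthonormalBasis ι ℝ V) (J : V →L[ℝ] V) (η : V [⋀^Fin (n + 2)]→ₗ[ℝ] ℝ) :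
    kahlerContraction J η = ∑ k, interiorTwo (e k) (J (e k)) η := by
  rw [kahlerContraction, LinearMap.sum_apply]
  exact sum_apply_self_eq (stdOrthonormalBasis ℝ V) e
    ((AlternatingMap.curryLeftLinearMap ∘ₗ η.curryLeft).compl₂ J.toLinearMap)

end Contraction

section ComplexBasis

variable {V : Type*} [NormedAddCommGroup V] [InnerProductSpace ℝ V]
  {J : V →L[ℝ] V} {e : OrthonormalBasis (Fin 8) ℝ V} {n : ℕ}

theorem IsComplexBasis.inner_apply (he : IsComplexBasis J e.toBasis) (hJ : J * J = -1)
    (skew : IsSkewEnd J) (u v : V) :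
    inner ℝ (J u) v = inner ℝ (e 0) u * inner ℝ (e 1) v - inner ℝ (e 1) u * inner ℝ (e 0) v
      + inner ℝ (e 2) u * inner ℝ (e 3) v - inner ℝ (e 3) u * inner ℝ (e 2) v
      + inner ℝ (e 4) u * inner ℝ (e 5) v - inner ℝ (e 5) u * inner ℝ (e 4) v
      + inner ℝ (e 6) u * inner ℝ (e 7) v - inner ℝ (e 7) u * inner ℝ (e 6) v := by
  have sq (w : V) : J (J w) = -w := congrArg (fun f => f w) hJ
  obtain ⟨e_one, e_three, e_five, e_seven⟩ := he
  simp only [OrthonormalBasis.coe_toBasis] at e_one e_three e_five e_seven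
  rw [← e.sum_inner_mul_inner (J u) v, Fin.sum_univ_eight]
  simp only [skew u, e_one, e_three, e_five, e_seven, sq, inner_neg_right, real_inner_comm u]
  ring

theorem interiorTwo_interiorTwo_det (e : OrthonormalBasis (Fin 8) ℝ V)
    {σ : Equiv.Perm (Fin 8)} (hσ : Equiv.Perm.sign σ = 1) {s : Fin 8 → Fin 8} (hs : ⇑σ = s)
    (x : Fin 4 → V) :
    interiorTwo (e (s 6)) (e (s 7)) (interiorTwo (e (s 4)) (e (s 5)) e.toBasis.det) x =
      (Matrix.of fun i j : Fin 4 => inner ℝ (e (s (Fin.castAdd 4 i))) (x j)).det := by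
  subst hs
  have minor := det_append_basis_perm e.toBasis hσ x
  simp only [OrthonormalBasis.coe_toBasis, OrthonormalBasis.coe_toBasis_repr_apply,
    OrthonormalBasis.repr_apply_apply] at minor
  rw [← minor]
  refine congrArg e.toBasis.det ?_
  ext1 i
  fin_cases i <;> rfl

theorem sum_inner_mul_inner_apply {ι : Type*} [Fintype ι] (e : OrthonormalBasis ι ℝ V)
    (J : V →L[ℝ] V) (u v : V) :
    ∑ k, inner ℝ u (e k) * inner ℝ v (J (e k)) = kahlerForm J u v := by
  have J_u : J u = ∑ k, inner ℝ u (e k) • J (e k) := by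
    conv_lhs => rw [← e.sum_repr' u, map_sum]
    simp only [map_smul, real_inner_comm]
  simp only [kahlerForm, LinearMap.comp_apply, innerₗ_apply_apply, ContinuousLinearMap.coe_coe,
    real_inner_comm v, J_u, inner_sum, inner_smul_right]

theorem interiorTwo_interiorTwo_det_apply_last (e : OrthonormalBasis (Fin 8) ℝ V) (w : Fin 4 → V) :
    interiorTwo (w 2) (w 3) (interiorTwo (n := 6) (w 0) (w 1) e.toBasis.det)
      ![e 4, e 5, e 6, e 7] =
      (Matrix.of fun i j : Fin 4 => inner ℝ (e (Fin.castAdd 4 i)) (w j)).det := by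
  have det_eq := det_append_basis (m := 4) (n := 4) e.toBasis w
  simp only [OrthonormalBasis.coe_toBasis, OrthonormalBasis.coe_toBasis_repr_apply,
    OrthonormalBasis.repr_apply_apply] at det_eq
  rw [← det_eq]
  refine congrArg e.toBasis.det ?_
  ext1 i
  fin_cases i <;> rfl

variable [FiniteDimensional ℝ V]

theorem IsComplexBasis.kahlerContraction_eq (he : IsComplexBasis J e.toBasis) (hJ : J * J = -1)
    (η : V [⋀^Fin (n + 2)]→ₗ[ℝ] ℝ) :
    kahlerContraction J η = (2 : ℝ) • (interiorTwo (e 0) (e 1) η + interiorTwo (e 2) (e 3) η +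
      interiorTwo (e 4) (e 5) η + interiorTwo (e 6) (e 7) η) := by
  have sq (v : V) : J (J v) = -v := congrArg (fun f => f v) hJ
  obtain ⟨e_one, e_three, e_five, e_seven⟩ := he
  simp only [OrthonormalBasis.coe_toBasis] at e_one e_three e_five e_seven
  rw [kahlerContraction_eq_sum e, Fin.sum_univ_eight]
  simp only [e_one, e_three, e_five, e_seven, sq, interiorTwo_neg_swap]
  module

theorem IsComplexBasis.kahlerContraction_kahlerContraction (he : IsComplexBasis J e.toBasis)
    (hJ : J * J = -1) (η : V [⋀^Fin (n + 4)]→ₗ[ℝ] ℝ) :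
    kahlerContraction J (kahlerContraction J η) = (8 : ℝ) •
      (interiorTwo (e 2) (e 3) (interiorTwo (e 0) (e 1) η) +
        interiorTwo (e 4) (e 5) (interiorTwo (e 0) (e 1) η) +
        interiorTwo (e 6) (e 7) (interiorTwo (e 0) (e 1) η) +
        interiorTwo (e 4) (e 5) (interiorTwo (e 2) (e 3) η) +
        interiorTwo (e 6) (e 7) (interiorTwo (e 2) (e 3) η) +
        interiorTwo (e 6) (e 7) (interiorTwo (e 4) (e 5) η)) := by
  simp only [he.kahlerContraction_eq hJ, map_smul, map_add, interiorTwo_interiorTwo_self]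
  rw [interiorTwo_comm (e 0) (e 1) (e 2) (e 3), interiorTwo_comm (e 0) (e 1) (e 4) (e 5),
    interiorTwo_comm (e 0) (e 1) (e 6) (e 7), interiorTwo_comm (e 2) (e 3) (e 4) (e 5),
    interiorTwo_comm (e 2) (e 3) (e 6) (e 7), interiorTwo_comm (e 4) (e 5) (e 6) (e 7)]
  module

theorem IsComplexBasis.kahlerContraction_kahlerContraction_det (he : IsComplexBasis J e.toBasis)
    (hJ : J * J = -1) (skew : IsSkewEnd J) :
    kahlerContraction J (kahlerContraction (n := 6) J e.toBasis.det) =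
      (4 : ℝ) • kahlerSq J := by
  ext x
  have minor {σ : Equiv.Perm (Fin 8)} (hσ : Equiv.Perm.sign σ = 1) {s : Fin 8 → Fin 8}
      (hs : ⇑σ = s) := interiorTwo_interiorTwo_det e hσ hs x
  have minor₂₃ := minor (σ := c[0, 4] * c[1, 5] * c[2, 6] * c[3, 7]) (by decide)
    (s := ![4, 5, 6, 7, 0, 1, 2, 3]) (by decide)
  have minor₁₃ := minor (σ := c[0, 2, 6, 4] * c[1, 3, 7, 5]) (by decide)
    (s := ![2, 3, 6, 7, 0, 1, 4, 5]) (by decide)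
  have minor₁₂ := minor (σ := c[0, 2, 4] * c[1, 3, 5]) (by decide)
    (s := ![2, 3, 4, 5, 0, 1, 6, 7]) (by decide)
  have minor₀₃ := minor (σ := c[2, 6, 4] * c[3, 7, 5]) (by decide)
    (s := ![0, 1, 6, 7, 2, 3, 4, 5]) (by decide)
  have minor₀₂ := minor (σ := c[2, 4] * c[3, 5]) (by decide)
    (s := ![0, 1, 4, 5, 2, 3, 6, 7]) (by decide)
  have minor₀₁ := minor (σ := 1) Equiv.Perm.sign_one (s := ![0, 1, 2, 3, 4, 5, 6, 7]) (by decide)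
  have castAdd_zero : Fin.castAdd 4 (0 : Fin 4) = (0 : Fin 8) := rfl
  have castAdd_one : Fin.castAdd 4 (1 : Fin 4) = (1 : Fin 8) := rfl
  have castAdd_two : Fin.castAdd 4 (2 : Fin 4) = (2 : Fin 8) := rfl
  have castAdd_three : Fin.castAdd 4 (3 : Fin 4) = (3 : Fin 8) := rfl
  simp only [det_fin_four, Matrix.of_apply, castAdd_zero, castAdd_one, castAdd_two, castAdd_three,
    Matrix.cons_val] at minor₀₁ minor₀₂ minor₀₃ minor₁₂ minor₁₃ minor₂₃
  rw [he.kahlerContraction_kahlerContraction hJ, AlternatingMap.smul_apply,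
    AlternatingMap.smul_apply, skew.kahlerSq_apply]
  simp only [AlternatingMap.add_apply, he.inner_apply hJ skew, smul_eq_mul]
  rw [minor₀₁, minor₀₂, minor₀₃, minor₁₂, minor₁₃, minor₂₃]
  ring

theorem kahlerContraction_kahlerContraction_det_apply (e : OrthonormalBasis (Fin 8) ℝ V)
    (J : V →L[ℝ] V) :
    kahlerContraction J (kahlerContraction (n := 6) J e.toBasis.det) ![e 4, e 5, e 6, e 7] =
      4 * kahlerSq J ![e 0, e 1, e 2, e 3] := by
  have frame : ![e 0, e 1, e 2, e 3] = fun i => e (Fin.castAdd 4 i) := by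
    ext1 i
    fin_cases i <;> rfl
  have sum_apply (f : Fin 8 → V [⋀^Fin 4]→ₗ[ℝ] ℝ) (x : Fin 4 → V) :
      (∑ l, f l) x = ∑ l, f l x :=
    map_sum (AddMonoidHom.mk' (fun η : V [⋀^Fin 4]→ₗ[ℝ] ℝ => η x) fun _ _ => rfl) f
      Finset.univ
  calc _ = ∑ l, ∑ k, (Matrix.of fun i j : Fin 4 => inner ℝ (e (Fin.castAdd 4 i))
            (![e k, J (e k), e l, J (e l)] j)).det := by
        rw [kahlerContraction_eq_sum e, kahlerContraction_eq_sum e]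
        simp only [map_sum, sum_apply]
        exact Finset.sum_congr rfl fun l _ => Finset.sum_congr rfl fun k _ =>
          interiorTwo_interiorTwo_det_apply_last e ![e k, J (e k), e l, J (e l)]
    _ = ∑ σ : Equiv.Perm (Fin 4), (Equiv.Perm.sign σ : ℤ) *
          (kahlerForm J (e (Fin.castAdd 4 (σ 0))) (e (Fin.castAdd 4 (σ 1))) *
            kahlerForm J (e (Fin.castAdd 4 (σ 2))) (e (Fin.castAdd 4 (σ 3)))) := by
        simp only [Matrix.det_apply', Fin.prod_univ_four, Matrix.of_apply, Matrix.cons_val,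
          ← sum_inner_mul_inner_apply e J, Finset.sum_mul, Finset.mul_sum]
        rw [Finset.sum_congr rfl fun l _ => Finset.sum_comm, Finset.sum_comm]
        refine Finset.sum_congr rfl fun σ _ => Finset.sum_congr rfl fun l _ =>
          Finset.sum_congr rfl fun k _ => ?_
        ring
    _ = 4 * kahlerSq J ![e 0, e 1, e 2, e 3] := by
        rw [kahlerSq, wedgeTwo_apply, frame]
        ring

theorem IsPosOrthComplexStructure.isSelfDual_kahlerSq {o : Orientation ℝ V (Fin 8)}
    (h : IsPosOrthComplexStructure o J) (he : IsComplexBasis J e.toBasis) :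
    IsSelfDual o (kahlerSq J) := by
  intro b hb
  have orientation_eq : e.toBasis.orientation = o :=
    h.positive _ he.1 he.2.1 he.2.2.1 he.2.2.2
  have det_eq : b.toBasis.det = e.toBasis.det :=
    OrthonormalBasis.same_orientation_iff_det_eq_det.2 (hb.trans orientation_eq.symm)
  have last_four := kahlerContraction_kahlerContraction_det_apply b J
  rw [det_eq, he.kahlerContraction_kahlerContraction_det h.mul_self h.skew,
    AlternatingMap.smul_apply, smul_eq_mul] at last_four
  exact mul_left_cancel₀ four_ne_zero last_four

end ComplexBasis

section HKForm

variable {V : Type*} [NormedAddCommGroup V] [InnerProductSpace ℝ V]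
  {o : Orientation ℝ V (Fin 8)}

theorem IsSelfDual.add {α β : V [⋀^Fin 4]→ₗ[ℝ] ℝ} (hα : IsSelfDual o α) (hβ : IsSelfDual o β) :
    IsSelfDual o (α + β) := fun e he => by
  simp only [AlternatingMap.add_apply, hα e he, hβ e he]

theorem IsSelfDual.smul {α : V [⋀^Fin 4]→ₗ[ℝ] ℝ} (hα : IsSelfDual o α) (c : ℝ) :
    IsSelfDual o (c • α) := fun e he => by
  simp only [AlternatingMap.smul_apply, hα e he]

theorem IsHKTriple.isSelfDual_hkForm [FiniteDimensional ℝ V] (hV : Module.finrank ℝ V = 8)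
    {J : Fin 3 → V →L[ℝ] V} (h : IsHKTriple o J) : IsSelfDual o (hkForm J) := by
  have : Nontrivial V := Module.nontrivial_of_finrank_pos (R := ℝ) (by omega)
  obtain ⟨v, hv⟩ := exists_norm_eq V (zero_le_one (α := ℝ))
  have selfDual {I K : V →L[ℝ] V} (hI : IsPosOrthComplexStructure o I) (pair : IsQuatPair I K) :
      IsSelfDual o (kahlerSq I) := by
    obtain ⟨e, u, he⟩ := pair.exists_orthonormalBasis hV hv
    exact hI.isSelfDual_kahlerSq (e := e) ⟨by simp [he], by simp [he], by simp [he], by simp [he]⟩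
  have pair : IsQuatPair (J 0) (J 1) := h.isQuatPair
  have pair' : IsQuatPair (J 2) (J 0) := by
    rw [h.eq_mul]
    exact pair.pair_mul.symm
  rw [hkForm, Fin.sum_univ_three]
  exact (((selfDual (h.complex 0) pair).add (selfDual (h.complex 1) pair.symm)).add
    (selfDual (h.complex 2) pair')).smul _

end HKForm

end SelfDual

section QuaternionicHermitian

section Anticommutator

variable {R : Type*} [Ring R] {i j k : R}

theorem commute_anticommutator_of_sq (hj : j * j = -1) (k : R) : Commute j (j * k + k * j) := by
  rw [commute_iff_eq, mul_add, add_mul, ← mul_assoc, hj, mul_assoc k, hj, mul_assoc, neg_one_mul,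
    mul_neg_one, add_comm]

theorem commute_mul_of_anticomm (hj : i * j = -(j * i)) (hk : i * k = -(k * i)) :
    Commute i (j * k) := by
  rw [commute_iff_eq, ← mul_assoc, hj, neg_mul, mul_assoc, hk, mul_neg, neg_neg, mul_assoc]

theorem anticommutator_sq_add_sq (hi : i * i = -1) (hj : j * j = -1) (hk : k * k = -1)
    (hij : i * j = -(j * i)) (hik : i * k = -(k * i)) :
    (j * k + k * j) * (j * k + k * j) +
      (j * (i * k) + i * k * j) * (j * (i * k) + i * k * j) = 4 := by
  have inv_left : j * k * (k * j) = 1 := by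
    rw [mul_assoc, ← mul_assoc k, hk, neg_one_mul, mul_neg, hj, neg_neg]
  have inv_right : k * j * (j * k) = 1 := by
    rw [mul_assoc, ← mul_assoc j, hj, neg_one_mul, mul_neg, hk, neg_neg]
  have commute : Commute i (j * k - k * j) :=
    (commute_mul_of_anticomm hij hik).sub_right (commute_mul_of_anticomm hik hij)
  have eq_commutator : j * (i * k) + i * k * j = -(i * (j * k - k * j)) := by
    rw [mul_sub, ← mul_assoc, ← mul_assoc, ← mul_assoc, hij]
    noncomm_ring
  have sq_eq : (j * (i * k) + i * k * j) * (j * (i * k) + i * k * j) =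
      -((j * k - k * j) * (j * k - k * j)) := by
    rw [eq_commutator, neg_mul_neg, mul_assoc, ← mul_assoc (j * k - k * j), ← commute.eq,
      mul_assoc i (j * k - k * j), ← mul_assoc i i, hi, neg_one_mul]
  calc _ = 2 * (j * k * (k * j)) + 2 * (k * j * (j * k)) := by
        rw [sq_eq]
        noncomm_ring
    _ = 4 := by
        rw [inv_left, inv_right]
        norm_num

end Anticommutator

variable {V : Type*} [NormedAddCommGroup V] [InnerProductSpace ℝ V] {α β W : V →L[ℝ] V}

theorem IsSkewEnd.isSymmetric_anticommutator (hα : IsSkewEnd α) (hβ : IsSkewEnd β) :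
    (α * β + β * α).toLinearMap.IsSymmetric := fun u v => by
  simp only [ContinuousLinearMap.coe_coe, add_apply, mul_apply_eq_comp, inner_add_left,
    inner_add_right, hα _ _, hβ _ _, neg_neg, add_comm]

theorem IsSkewEnd.inner_apply_eq_zero_of_commute (hα : IsSkewEnd α)
    (hW : W.toLinearMap.IsSymmetric) (h : Commute α W) (v : V) :
    inner ℝ (α v) (W v) = (0 : ℝ) := by
  have neg_self : inner ℝ (α v) (W v) = -(inner ℝ (α v) (W v) : ℝ) := by
    conv_lhs => rw [hα, ← mul_apply_eq_comp, h.eq, real_inner_comm]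
    exact congrArg Neg.neg (hW _ _)
  linarith

variable [FiniteDimensional ℝ V] (hV : Module.finrank ℝ V = 8) {I J J' : V →L[ℝ] V}
include hV

theorem IsQuatPair.exists_diagonal_of_commute (h : IsQuatPair I J)
    (hW : W.toLinearMap.IsSymmetric) (hI : Commute I W) (hJ : Commute J W) :
    ∃ (b : OrthonormalBasis (Fin 8) ℝ V) (a c : ℝ),
      ∀ i, W (b i) = (![a, a, a, a, c, c, c, c] i) • b i := by
  set v := hW.eigenvectorBasis hV 0
  set a := hW.eigenvalues hV 0
  have W_v : W v = a • v := hW.apply_eigenvectorBasis hV 0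
  obtain ⟨b, u, hb⟩ := h.exists_orthonormalBasis hV
    (v := v) ((hW.eigenvectorBasis hV).orthonormal.1 0)
  have W_I (x : V) : W (I x) = I (W x) := (DFunLike.congr_fun hI.eq x).symm
  have W_J (x : V) : W (J x) = J (W x) := (DFunLike.congr_fun hJ.eq x).symm
  have inner_first (i : Fin 8) (hi : i < 4) : inner ℝ (b i) (W u) = (0 : ℝ) := by
    have W_b : W (b i) = a • b i := by
      fin_cases i <;> simp at hi <;> simp [hb, W_I, W_J, W_v]
    have u_eq : u = b 4 := by simp [hb]
    calc inner ℝ (b i) (W u) = inner ℝ (W (b i)) u := (hW (b i) u).symm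
      _ = 0 := by rw [W_b, inner_smul_left, u_eq, b.inner_eq_zero hi.ne, mul_zero]
  have inner_five : inner ℝ (b 5) (W u) = (0 : ℝ) := by
    simpa [hb] using h.skew_left.inner_apply_eq_zero_of_commute hW hI u
  have inner_six : inner ℝ (b 6) (W u) = (0 : ℝ) := by
    simpa [hb] using h.skew_right.inner_apply_eq_zero_of_commute hW hJ u
  have inner_seven : inner ℝ (b 7) (W u) = (0 : ℝ) := by
    simpa [hb] using h.skew_mul.inner_apply_eq_zero_of_commute hW (hI.mul_left hJ) u
  obtain ⟨c, W_u⟩ : ∃ c : ℝ, W u = c • u := by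
    refine ⟨inner ℝ (b 4) (W u), ?_⟩
    conv_lhs => rw [← b.sum_repr' (W u), Fin.sum_univ_eight, inner_first 0 (by decide),
      inner_first 1 (by decide), inner_first 2 (by decide), inner_first 3 (by decide),
      inner_five, inner_six, inner_seven]
    simp [hb]
  refine ⟨b, a, c, fun i => ?_⟩
  fin_cases i <;> simp [hb, W_I, W_J, W_v, W_u]

-- The Cayley–Hamilton theorem for quaternionic Hermitian endomorphisms of `ℍ²`.
theorem IsQuatPair.exists_mul_self_eq (h : IsQuatPair I J) (hW : W.toLinearMap.IsSymmetric)
    (hI : Commute I W) (hJ : Commute J W) :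
    ∃ d : ℝ, W * W = (endTrace W / 4) • W - d • 1 := by
  obtain ⟨b, a, c, W_b⟩ := h.exists_diagonal_of_commute hV hW hI hJ
  have trace_W : endTrace W = 4 * (a + c) := by
    simp only [endTrace_eq_sum b, W_b, inner_smul_right, real_inner_self_eq_norm_sq,
      b.norm_eq_one, Fin.sum_univ_eight, Matrix.cons_val]
    ring
  refine ⟨a * c, ContinuousLinearMap.coe_injective (b.toBasis.ext fun i => ?_)⟩
  simp only [OrthonormalBasis.coe_toBasis, ContinuousLinearMap.coe_coe, mul_apply_eq_comp,
    sub_apply, smul_apply, one_apply_eq_self, W_b, map_smul, trace_W, smul_smul, ← sub_smul]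
  congr 1
  fin_cases i <;> simp <;> ring

theorem endInner_eq_of_anticommutator {c : ℝ} (h : α * β + β * α = c • 1) :
    endInner α β = -c / 2 := by
  have trace_eq := congrArg endTrace h
  rw [map_add, endTrace_mul_comm β α, map_smul, endTrace_one_of_finrank hV, smul_eq_mul]
    at trace_eq
  rw [endInner_apply]
  linarith

theorem IsQuatPair.anticommutator_eq (h : IsQuatPair I J) (h' : IsQuatPair I J')
    (orth : endInner J (I * J') = 0) (ne_zero : endInner J J' ≠ 0) :
    J * J' + J' * J = (-2 * endInner J J') • 1 := by
  set S := J * J' + J' * J with S_eq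
  set T := J * (I * J') + I * J' * J with T_eq
  have commute_I {β : V →L[ℝ] V} (hβ : I * β = -(β * I)) : Commute I (J * β + β * J) :=
    (commute_mul_of_anticomm h.anticomm hβ).add_right (commute_mul_of_anticomm hβ h.anticomm)
  have trace_S : endTrace S = -16 * endInner J J' := by
    rw [S_eq, map_add, endTrace_mul_comm J' J, endTrace_mul]; ring
  have trace_T : endTrace T = 0 := by
    rw [T_eq, map_add, endTrace_mul_comm (I * J') J, endTrace_mul, orth]; ring
  obtain ⟨d, S_sq⟩ := h.exists_mul_self_eq hV
    (h.skew_right.isSymmetric_anticommutator h'.skew_right) (commute_I h'.anticomm)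
    (commute_anticommutator_of_sq h.sq_right J')
  obtain ⟨d', T_sq⟩ := h.exists_mul_self_eq hV
    (h.skew_right.isSymmetric_anticommutator h'.skew_mul) (commute_I h'.pair_mul.anticomm)
    (commute_anticommutator_of_sq h.sq_right (I * J'))
  have sq_add_sq : S * S + T * T = (4 : ℝ) • 1 := by
    rw [anticommutator_sq_add_sq h.sq_left h.sq_right h'.sq_right h.anticomm h'.anticomm,
      Algebra.smul_def, mul_one, map_ofNat]
  have scalar : (-4 * endInner J J') • S = (4 + d + d') • 1 := by
    rw [S_sq, T_sq, trace_S, trace_T] at sq_add_sq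
    rw [add_smul, add_smul, ← sq_add_sq]
    module
  have S_scalar : S = ((-4 * endInner J J')⁻¹ * (4 + d + d')) • 1 := by
    rw [mul_smul, ← scalar, inv_smul_smul₀ (mul_ne_zero (by norm_num) ne_zero)]
  rw [endInner_eq_of_anticommutator hV S_scalar, S_scalar]
  congr 1
  ring

end QuaternionicHermitian

section HKSpan

variable {V : Type*} [NormedAddCommGroup V] [InnerProductSpace ℝ V]

/-- The positive multiple of `α` of norm one for `endInner`; it is `0` if `endInner α α ≤ 0`. -/
def endNormalize (α : V →L[ℝ] V) : V →L[ℝ] V := (√(endInner α α))⁻¹ • α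

theorem endInner_endNormalize_left (α β : V →L[ℝ] V) :
    endInner (endNormalize α) β = (√(endInner α α))⁻¹ * endInner α β := by
  rw [endNormalize, map_smul, LinearMap.smul_apply, smul_eq_mul]

theorem endInner_endNormalize_right (α β : V →L[ℝ] V) :
    endInner β (endNormalize α) = (√(endInner α α))⁻¹ * endInner β α := by
  rw [endNormalize, map_smul, smul_eq_mul]

theorem endInner_endNormalize_self {α : V →L[ℝ] V} (h : 0 < endInner α α) :
    endInner (endNormalize α) (endNormalize α) = 1 := by
  rw [endInner_endNormalize_left, endInner_endNormalize_right, ← mul_assoc, ← mul_inv,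
    Real.mul_self_sqrt h.le, inv_mul_cancel₀ h.ne']

theorem endNormalize_of_unit {α : V →L[ℝ] V} (unit : endInner α α = 1) : endNormalize α = α := by
  rw [endNormalize, unit, Real.sqrt_one, inv_one, one_smul]

theorem IsSkewEnd.endInner_self_pos [FiniteDimensional ℝ V] {α : V →L[ℝ] V} (hα : IsSkewEnd α)
    (ne_zero : α ≠ 0) : 0 < endInner α α :=
  hα.endInner_self_nonneg.lt_of_ne' fun h => ne_zero (hα.eq_zero_of_endInner_self h)

/-- `E` is the space of imaginary quaternions of a positive quaternionic structure on `(V, o)`,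
given by the existence of a hyper-Kähler triple which spans it. -/
def IsHKSpan (o : Orientation ℝ V (Fin 8)) (E : Submodule ℝ (V →L[ℝ] V)) : Prop :=
  ∃ J : Fin 3 → V →L[ℝ] V, IsHKTriple o J ∧ E = Submodule.span ℝ (Set.range J)

variable {o : Orientation ℝ V (Fin 8)} {E : Submodule ℝ (V →L[ℝ] V)} {α β : V →L[ℝ] V}

theorem IsHKSpan.skew (hE : IsHKSpan o E) (hα : α ∈ E) : IsSkewEnd α := by
  obtain ⟨J, h, rfl⟩ := hE
  induction hα using Submodule.span_induction with
  | mem x hx => obtain ⟨i, rfl⟩ := hx; exact (h.complex i).skew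
  | zero => intro u v; simp
  | add x y _ _ hx hy => exact hx.add hy
  | smul c x _ hx => exact hx.smul c

variable [FiniteDimensional ℝ V] (hV : Module.finrank ℝ V = 8)
include hV

namespace IsHKTriple

variable {J : Fin 3 → V →L[ℝ] V}

theorem endInner_eq (h : IsHKTriple o J) (i k : Fin 3) :
    endInner (J i) (J k) = if i = k then 1 else 0 := by
  have q := h.isQuatPair
  split_ifs with hik
  · rw [hik, endInner_self_of_sq hV (h.complex k).mul_self]
  · refine endInner_eq_zero_of_anticomm ?_
    rw [h.eq_cons]
    fin_cases i <;> fin_cases k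
    exacts [absurd rfl hik, q.anticomm, q.pair_mul.anticomm, q.symm.anticomm, absurd rfl hik,
      q.rotate.anticomm, q.pair_mul.symm.anticomm, q.rotate.symm.anticomm, absurd rfl hik]

theorem linearIndependent (h : IsHKTriple o J) : LinearIndependent ℝ J := by
  rw [Fintype.linearIndependent_iff]
  intro g hg k
  have inner_eq_zero := congrArg (fun α => endInner α (J k)) hg
  simpa [h.endInner_eq hV, LinearMap.sum_apply] using inner_eq_zero

theorem mul_add_mem_span (h : IsHKTriple o J) (i k : Fin 3) :
    J i * J k + endInner (J i) (J k) • 1 ∈ Submodule.span ℝ (Set.range J) := by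
  have q := h.isQuatPair
  have sq (i : Fin 3) : J i * J i = -1 := (h.complex i).mul_self
  have mem (i : Fin 3) : J i ∈ Submodule.span ℝ (Set.range J) := Submodule.subset_span ⟨i, rfl⟩
  have two_zero : J 2 * J 0 = J 1 := by
    rw [h.eq_mul, q.pair_mul.symm.anticomm, q.mul_mul_left, neg_neg]
  have one_two : J 1 * J 2 = J 0 := by
    rw [h.eq_mul, q.rotate.anticomm, q.mul_mul_right, neg_neg]
  rw [h.endInner_eq hV]
  fin_cases i <;> fin_cases k
  · simp [sq]
  · simpa [← h.eq_mul] using mem 2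
  · simpa [h.eq_mul, q.mul_mul_left] using mem 1
  · simpa [q.symm.anticomm, ← h.eq_mul] using mem 2
  · simp [sq]
  · simpa [one_two] using mem 0
  · simpa [two_zero] using mem 1
  · simpa [h.eq_mul, q.mul_mul_right] using mem 0
  · simp [sq]

end IsHKTriple

namespace IsHKSpan

theorem finrank_eq (hE : IsHKSpan o E) : Module.finrank ℝ E = 3 := by
  obtain ⟨J, h, rfl⟩ := hE
  rw [finrank_span_eq_card (h.linearIndependent hV), Fintype.card_fin]

theorem mul_add_mem (hE : IsHKSpan o E) (hα : α ∈ E) (hβ : β ∈ E) :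
    α * β + endInner α β • 1 ∈ E := by
  obtain ⟨J, h, rfl⟩ := hE
  let B : (V →L[ℝ] V) →ₗ[ℝ] (V →L[ℝ] V) →ₗ[ℝ] V →L[ℝ] V :=
    LinearMap.mul ℝ (V →L[ℝ] V) + endInner.compr₂ (LinearMap.toSpanSingleton ℝ (V →L[ℝ] V) 1)
  have map₂_le : Submodule.map₂ B (Submodule.span ℝ (Set.range J))
      (Submodule.span ℝ (Set.range J)) ≤ Submodule.span ℝ (Set.range J) := by
    rw [Submodule.map₂_span_span, Submodule.span_le]
    rintro _ ⟨_, ⟨i, rfl⟩, _, ⟨k, rfl⟩, rfl⟩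
    exact h.mul_add_mem_span hV i k
  exact map₂_le (Submodule.apply_mem_map₂ B hα hβ)

theorem anticommutator_eq (hE : IsHKSpan o E) (hα : α ∈ E) (hβ : β ∈ E) :
    α * β + β * α = (-2 * endInner α β) • 1 := by
  have skew := hE.skew (hE.mul_add_mem hV hα hβ)
  have adjoint (u v : V) : inner ℝ ((α * β) u) v = (inner ℝ u ((β * α) v) : ℝ) := by
    rw [mul_apply_eq_comp, mul_apply_eq_comp, hE.skew hα, hE.skew hβ, neg_neg]
  ext1 v
  refine ext_inner_left ℝ fun u => ?_
  have skew_uv := skew u v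
  simp only [add_apply, inner_add_left, inner_add_right, smul_apply, one_apply_eq_self,
    inner_smul_left, inner_smul_right, adjoint, conj_trivial] at skew_uv ⊢
  linarith

theorem mul_self (hE : IsHKSpan o E) (hα : α ∈ E) (unit : endInner α α = 1) : α * α = -1 := by
  have two_smul_eq := hE.anticommutator_eq hV hα hα
  rw [unit, ← two_smul ℝ] at two_smul_eq
  refine smul_right_injective _ (two_ne_zero (α := ℝ)) (two_smul_eq.trans ?_)
  module

theorem isQuatPair (hE : IsHKSpan o E) (hα : α ∈ E) (hβ : β ∈ E) (unit_α : endInner α α = 1)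
    (unit_β : endInner β β = 1) (orth : endInner α β = 0) : IsQuatPair α β where
  skew_left := hE.skew hα
  skew_right := hE.skew hβ
  sq_left := hE.mul_self hV hα unit_α
  sq_right := hE.mul_self hV hβ unit_β
  anticomm := by
    have anticommutator := hE.anticommutator_eq hV hα hβ
    rw [orth, mul_zero, zero_smul] at anticommutator
    exact eq_neg_of_add_eq_zero_left anticommutator

theorem exists_unit (hE : IsHKSpan o E) (β γ : V →L[ℝ] V) :
    ∃ α ∈ E, endInner α α = 1 ∧ endInner α β = 0 ∧ endInner α γ = 0 := by
  let f : E →ₗ[ℝ] ℝ × ℝ := ((endInner β).prod (endInner γ)).comp E.subtype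
  have ker_ne_bot : LinearMap.ker f ≠ ⊥ := LinearMap.ker_ne_bot_of_finrank_lt (by
    rw [hE.finrank_eq hV]; simp)
  obtain ⟨α, hα, α_ne⟩ := Submodule.exists_mem_ne_zero_of_ne_bot ker_ne_bot
  obtain ⟨orth_β, orth_γ⟩ : endInner β (α : V →L[ℝ] V) = 0 ∧ endInner γ (α : V →L[ℝ] V) = 0 := by
    simpa [f] using hα
  have pos := (hE.skew α.2).endInner_self_pos (Subtype.coe_ne_coe.2 α_ne)
  refine ⟨endNormalize α, E.smul_mem _ α.2, endInner_endNormalize_self pos, ?_, ?_⟩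
  · rw [endInner_endNormalize_left, endInner_comm _ β, orth_β, mul_zero]
  · rw [endInner_endNormalize_left, endInner_comm _ γ, orth_γ, mul_zero]

-- Being a positive complex structure passes from one member of a quaternionic pair to the other,
-- so it passes from a member of the spanning triple to `α` through a unit orthogonal to both.
theorem isPosOrthComplexStructure (hE : IsHKSpan o E) (hα : α ∈ E) (unit : endInner α α = 1) :
    IsPosOrthComplexStructure o α := by
  obtain ⟨J, h, E_eq⟩ := id hE
  have J_mem : J 0 ∈ E := E_eq ▸ Submodule.subset_span ⟨0, rfl⟩
  obtain ⟨β, hβ, unit_β, orth_α, orth_J⟩ := hE.exists_unit hV α (J 0)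
  have pos_β : IsPosOrthComplexStructure o β := (h.complex 0).of_isQuatPair hV
    (hE.isQuatPair hV J_mem hβ (by simp [h.endInner_eq hV]) unit_β
      (by rw [endInner_comm, orth_J]))
  exact pos_β.of_isQuatPair hV (hE.isQuatPair hV hβ hα unit_β unit orth_α)

theorem mul_mem (hE : IsHKSpan o E) (hα : α ∈ E) (hβ : β ∈ E) (orth : endInner α β = 0) :
    α * β ∈ E := by
  simpa [orth] using hE.mul_add_mem hV hα hβ

theorem isHKTriple (hE : IsHKSpan o E) (hα : α ∈ E) (hβ : β ∈ E) (unit_α : endInner α α = 1)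
    (unit_β : endInner β β = 1) (orth : endInner α β = 0) : IsHKTriple o ![α, β, α * β] :=
  IsHKTriple.of_isQuatPair hV (hE.isPosOrthComplexStructure hV hα unit_α)
    (hE.isQuatPair hV hα hβ unit_α unit_β orth)

theorem eq_span (hE : IsHKSpan o E) (hα : α ∈ E) (hβ : β ∈ E) (unit_α : endInner α α = 1)
    (unit_β : endInner β β = 1) (orth : endInner α β = 0) :
    E = Submodule.span ℝ (Set.range ![α, β, α * β]) := by
  have triple := hE.isHKTriple hV hα hβ unit_α unit_β orth
  refine (Submodule.eq_of_le_of_finrank_eq (Submodule.span_le.2 ?_) ?_).symm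
  · rintro _ ⟨i, rfl⟩
    fin_cases i
    exacts [hα, hβ, hE.mul_mem hV hα hβ orth]
  · rw [hE.finrank_eq hV, finrank_span_eq_card (triple.linearIndependent hV), Fintype.card_fin]

end IsHKSpan

end HKSpan

section HKProj

variable {V : Type*} [NormedAddCommGroup V] [InnerProductSpace ℝ V]

/-- The orthogonal projection onto the span of `J`, for an orthonormal triple `J` with respect to
`endInner`. -/
def hkProj (J : Fin 3 → V →L[ℝ] V) : (V →L[ℝ] V) →ₗ[ℝ] V →L[ℝ] V :=
  ∑ j, (endInner (J j)).smulRight (J j)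

theorem hkProj_apply (J : Fin 3 → V →L[ℝ] V) (α : V →L[ℝ] V) :
    hkProj J α = ∑ j, endInner (J j) α • J j := by
  simp only [hkProj, LinearMap.sum_apply, LinearMap.smulRight_apply]

theorem hkProj_mem (J : Fin 3 → V →L[ℝ] V) (α : V →L[ℝ] V) :
    hkProj J α ∈ Submodule.span ℝ (Set.range J) := by
  rw [hkProj_apply]
  exact Submodule.sum_mem _ fun j _ => Submodule.smul_mem _ _ (Submodule.subset_span ⟨j, rfl⟩)

namespace IsHKTriple

variable {o : Orientation ℝ V (Fin 8)} {J J' : Fin 3 → V →L[ℝ] V} {α β : V →L[ℝ] V}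

theorem isHKSpan (h : IsHKTriple o J) : IsHKSpan o (Submodule.span ℝ (Set.range J)) :=
  ⟨J, h, rfl⟩

variable [FiniteDimensional ℝ V] (hV : Module.finrank ℝ V = 8)
include hV

theorem endInner_hkProj (h : IsHKTriple o J) (α : V →L[ℝ] V)
    (hβ : β ∈ Submodule.span ℝ (Set.range J)) : endInner (hkProj J α) β = endInner α β := by
  induction hβ using Submodule.span_induction with
  | mem x hx =>
    obtain ⟨i, rfl⟩ := hx
    simp [hkProj_apply, LinearMap.sum_apply, h.endInner_eq hV, endInner_comm α]
  | zero => simp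
  | add x y _ _ hx hy => simp [hx, hy]
  | smul c x _ hx => simp [hx]

theorem hkProj_eq (h : IsHKTriple o J) (hβ : β ∈ Submodule.span ℝ (Set.range J))
    (inner_eq : ∀ γ ∈ Submodule.span ℝ (Set.range J), endInner β γ = endInner α γ) :
    hkProj J α = β := by
  have sub_mem := Submodule.sub_mem _ (hkProj_mem J α) hβ
  refine sub_eq_zero.1 ((h.isHKSpan.skew sub_mem).eq_zero_of_endInner_self ?_)
  rw [map_sub endInner, LinearMap.sub_apply, h.endInner_hkProj hV _ sub_mem, inner_eq _ sub_mem,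
    sub_self]

theorem hkProj_eq_self (h : IsHKTriple o J) (hα : α ∈ Submodule.span ℝ (Set.range J)) :
    hkProj J α = α :=
  h.hkProj_eq hV hα fun _ _ => rfl

theorem hkProj_eq_of_span_eq (h : IsHKTriple o J) (h' : IsHKTriple o J')
    (span_eq : Submodule.span ℝ (Set.range J) = Submodule.span ℝ (Set.range J')) :
    hkProj J = hkProj J' :=
  LinearMap.ext fun α => h.hkProj_eq hV (span_eq ▸ hkProj_mem J' α) fun _ hγ =>
    h'.endInner_hkProj hV α (span_eq ▸ hγ)

end IsHKTriple

end HKProj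

section CommonFrame

variable {V : Type*} [NormedAddCommGroup V] [InnerProductSpace ℝ V] [FiniteDimensional ℝ V]
  {o : Orientation ℝ V (Fin 8)} {J J' : Fin 3 → V →L[ℝ] V} {I K : V →L[ℝ] V}

/-- For hyper-Kähler triples `J` and `J'` whose spans share a complex structure `I`, the squared
cosine of the angle between the complements of `I` in these spans (see
`IsCommonFrame.endInner_hkProj_self`). It is defined through `⟨Ω, Ω'⟩ = (14 + 16 cos²) / 9`, hence
depends smoothly on `J` and `J'` without a choice of `I`. -/
def hkCosSq (J J' : Fin 3 → V →L[ℝ] V) : ℝ := (9 * formInner (hkForm J) (hkForm J') - 14) / 16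

/-- `I` is a common unit element of the spans of the hyper-Kähler triples `J` and `J'`, and `K` is
a unit element of the first span orthogonal to `I`. -/
structure IsCommonFrame (o : Orientation ℝ V (Fin 8)) (J J' : Fin 3 → V →L[ℝ] V)
    (I K : V →L[ℝ] V) : Prop where
  left : IsHKTriple o J
  right : IsHKTriple o J'
  mem_left : I ∈ Submodule.span ℝ (Set.range J)
  mem_right : I ∈ Submodule.span ℝ (Set.range J')
  mem : K ∈ Submodule.span ℝ (Set.range J)
  unit_common : endInner I I = 1
  unit : endInner K K = 1
  orth : endInner I K = 0

theorem IsHKTriple.exists_common_unit (h : IsHKTriple o J) (hd : 1 ≤ Module.finrank ℝ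
      ↥(Submodule.span ℝ (Set.range J) ⊓ Submodule.span ℝ (Set.range J'))) :
    ∃ I ∈ Submodule.span ℝ (Set.range J), I ∈ Submodule.span ℝ (Set.range J') ∧
      endInner I I = 1 := by
  obtain ⟨⟨α, hα, hα'⟩, α_ne⟩ := Module.finrank_pos_iff_exists_ne_zero.1 (Nat.succ_le_iff.1 hd)
  have pos := (h.isHKSpan.skew hα).endInner_self_pos fun h => α_ne (Subtype.ext h)
  exact ⟨endNormalize α, Submodule.smul_mem _ _ hα, Submodule.smul_mem _ _ hα',
    endInner_endNormalize_self pos⟩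

variable (hV : Module.finrank ℝ V = 8)
include hV

theorem IsHKTriple.exists_isCommonFrame (h : IsHKTriple o J) (h' : IsHKTriple o J')
    (hd : 1 ≤ Module.finrank ℝ
      ↥(Submodule.span ℝ (Set.range J) ⊓ Submodule.span ℝ (Set.range J'))) :
    ∃ I K, IsCommonFrame o J J' I K := by
  obtain ⟨I, hI, hI', unit_I⟩ := h.exists_common_unit hd
  obtain ⟨K, hK, unit_K, orth, -⟩ := h.isHKSpan.exists_unit hV I I
  exact ⟨I, K, h, h', hI, hI', hK, unit_I, unit_K, by rw [endInner_comm, orth]⟩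

namespace IsCommonFrame

theorem isQuatPair (c : IsCommonFrame o J J' I K) : IsQuatPair I K :=
  c.left.isHKSpan.isQuatPair hV c.mem_left c.mem c.unit_common c.unit c.orth

theorem isHKTriple (c : IsCommonFrame o J J' I K) : IsHKTriple o ![I, K, I * K] :=
  c.left.isHKSpan.isHKTriple hV c.mem_left c.mem c.unit_common c.unit c.orth

theorem span_eq (c : IsCommonFrame o J J' I K) :
    Submodule.span ℝ (Set.range J) = Submodule.span ℝ (Set.range ![I, K, I * K]) :=
  c.left.isHKSpan.eq_span hV c.mem_left c.mem c.unit_common c.unit c.orth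

theorem hkForm_eq (c : IsCommonFrame o J J' I K) : hkForm ![I, K, I * K] = hkForm J :=
  hkForm_eq_of_span_eq c.left (c.isHKTriple hV) (c.span_eq hV).symm

theorem hkProj_left_apply (c : IsCommonFrame o J J' I K) (α : V →L[ℝ] V) :
    hkProj J α = endInner I α • I + endInner K α • K + endInner (I * K) α • (I * K) := by
  rw [c.left.hkProj_eq_of_span_eq hV (c.isHKTriple hV) (c.span_eq hV), hkProj_apply,
    Fin.sum_univ_three]
  rfl

theorem mul (c : IsCommonFrame o J J' I K) : IsCommonFrame o J J' I (I * K) where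
  left := c.left
  right := c.right
  mem_left := c.mem_left
  mem_right := c.mem_right
  mem := c.left.isHKSpan.mul_mem hV c.mem_left c.mem c.orth
  unit_common := c.unit_common
  unit := (c.isHKTriple hV).endInner_eq hV 2 2
  orth := (c.isHKTriple hV).endInner_eq hV 0 2

theorem exists_right (c : IsCommonFrame o J J' I K) : ∃ L, IsCommonFrame o J' J I L := by
  obtain ⟨L, hL, unit_L, orth, -⟩ := c.right.isHKSpan.exists_unit hV I I
  exact ⟨L, c.right, c.left, c.mem_right, c.mem_left, hL, c.unit_common, unit_L,
    by rw [endInner_comm, orth]⟩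

theorem endInner_hkProj (c : IsCommonFrame o J J' I K) : endInner I (hkProj J' K) = 0 := by
  rw [endInner_comm, c.right.endInner_hkProj hV _ c.mem_right, endInner_comm, c.orth]

theorem endInner_hkProj_right (c : IsCommonFrame o J J' I K) :
    endInner K (hkProj J' K) = hkCosSq J J' := by
  obtain ⟨L, c'⟩ := c.exists_right hV
  have form_inner := formInner_hkForm_of_common hV (c.isQuatPair hV) (c'.isQuatPair hV)
  rw [c.hkForm_eq hV, c'.hkForm_eq hV] at form_inner
  rw [hkCosSq, form_inner, c'.hkProj_left_apply hV, c.orth, zero_smul, zero_add,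
    map_add (endInner K), map_smul, map_smul, endInner_comm L, endInner_comm (I * L)]
  simp only [smul_eq_mul]
  ring

theorem endInner_hkProj_self (c : IsCommonFrame o J J' I K) :
    endInner (hkProj J' K) (hkProj J' K) = hkCosSq J J' := by
  rw [c.right.endInner_hkProj hV _ (hkProj_mem _ _), c.endInner_hkProj_right hV]

theorem hkCosSq_nonneg (c : IsCommonFrame o J J' I K) : 0 ≤ hkCosSq J J' := by
  rw [← c.endInner_hkProj_self hV]
  exact (c.right.isHKSpan.skew (hkProj_mem _ _)).endInner_self_nonneg

theorem anticomm_hkProj (c : IsCommonFrame o J J' I K) :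
    I * hkProj J' K = -(hkProj J' K * I) := by
  have anticommutator := c.right.isHKSpan.anticommutator_eq hV c.mem_right (hkProj_mem J' K)
  rw [c.endInner_hkProj hV, mul_zero, zero_smul] at anticommutator
  exact eq_neg_of_add_eq_zero_left anticommutator

theorem endInner_mul_hkProj (c : IsCommonFrame o J J' I K) :
    endInner K (I * hkProj J' K) = 0 := by
  rw [← c.right.endInner_hkProj hV _ (c.right.isHKSpan.mul_mem hV c.mem_right (hkProj_mem J' K)
    (c.endInner_hkProj hV))]
  refine endInner_eq_zero_of_anticomm ?_
  rw [← mul_assoc, c.anticomm_hkProj hV, neg_mul, neg_neg]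

theorem hkProj_hkProj (c : IsCommonFrame o J J' I K) :
    hkProj J (hkProj J' K) = hkCosSq J J' • K := by
  have mul_orth : endInner (I * K) (hkProj J' K) = 0 := by
    have swap : endInner (I * K) (hkProj J' K) = -endInner K (I * hkProj J' K) := by
      rw [c.anticomm_hkProj hV, map_neg, neg_neg]
      simp only [endInner_apply]
      rw [mul_assoc, endTrace_mul_comm, mul_assoc]
    rw [swap, c.endInner_mul_hkProj hV, neg_zero]
  rw [c.hkProj_left_apply hV, c.endInner_hkProj hV, c.endInner_hkProj_right hV, mul_orth]
  module

theorem hkProj_hkProj_sub (c : IsCommonFrame o J J' I K) {α : V →L[ℝ] V}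
    (hα : α ∈ Submodule.span ℝ (Set.range J)) :
    hkProj J (hkProj J' α) - hkCosSq J J' • α =
      ((1 - hkCosSq J J') * endInner I α) • I := by
  have α_eq := (c.left.hkProj_eq_self hV hα).symm.trans (c.hkProj_left_apply hV α)
  have fix_I : hkProj J (hkProj J' I) = I := by
    rw [c.right.hkProj_eq_self hV c.mem_right, c.left.hkProj_eq_self hV c.mem_left]
  generalize endInner I α = x, endInner K α = y, endInner (I * K) α = z at α_eq ⊢
  rw [α_eq]
  simp only [map_add, map_smul, fix_I, c.hkProj_hkProj hV, (c.mul hV).hkProj_hkProj hV]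
  module

theorem hkProj_hkProj_sub_mem (c : IsCommonFrame o J J' I K) {α : V →L[ℝ] V}
    (hα : α ∈ Submodule.span ℝ (Set.range J)) :
    hkProj J (hkProj J' α) - hkCosSq J J' • α ∈
      Submodule.span ℝ (Set.range J) ⊓ Submodule.span ℝ (Set.range J') := by
  rw [c.hkProj_hkProj_sub hV hα]
  exact Submodule.smul_mem _ _ ⟨c.mem_left, c.mem_right⟩

theorem hkCosSq_ne_one (c : IsCommonFrame o J J' I K) (hd : Module.finrank ℝ
      ↥(Submodule.span ℝ (Set.range J) ⊓ Submodule.span ℝ (Set.range J')) = 1) :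
    hkCosSq J J' ≠ 1 := by
  intro hc
  have K_eq : K - hkProj J' K = 0 := by
    refine ((c.left.isHKSpan.skew c.mem).sub
      (c.right.isHKSpan.skew (hkProj_mem J' K))).eq_zero_of_endInner_self ?_
    simp only [map_sub, LinearMap.sub_apply, c.endInner_hkProj_self hV,
      c.endInner_hkProj_right hV, endInner_comm _ K, c.unit, hc]
    norm_num
  have mem_right : K ∈ Submodule.span ℝ (Set.range J') := by
    rw [sub_eq_zero.1 K_eq]; exact hkProj_mem J' K
  have independent : LinearIndependent ℝ ![I, K] := by
    refine LinearIndependent.pair_iff.2 fun a b hab => ⟨?_, ?_⟩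
    · simpa [c.unit_common, c.orth] using congrArg (endInner I) hab
    · simpa [c.unit, endInner_comm K I, c.orth] using congrArg (endInner K) hab
  have span_le : Submodule.span ℝ (Set.range ![I, K]) ≤
      Submodule.span ℝ (Set.range J) ⊓ Submodule.span ℝ (Set.range J') := by
    rw [Submodule.span_le, Matrix.range_cons_cons_empty]
    rintro _ (rfl | rfl)
    exacts [⟨c.mem_left, c.mem_right⟩, ⟨c.mem, mem_right⟩]
  have two_le := Submodule.finrank_mono span_le
  rw [finrank_span_eq_card independent, hd] at two_le
  norm_num at two_le

theorem normalize_hkProj (c : IsCommonFrame o J J' I K) (pos : 0 < hkCosSq J J') :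
    IsCommonFrame o J' J I (endNormalize (hkProj J' K)) where
  left := c.right
  right := c.left
  mem_left := c.mem_right
  mem_right := c.mem_left
  mem := Submodule.smul_mem _ _ (hkProj_mem _ _)
  unit_common := c.unit_common
  unit := endInner_endNormalize_self (by rwa [c.endInner_hkProj_self hV])
  orth := by rw [endInner_endNormalize_right, c.endInner_hkProj hV, mul_zero]

end IsCommonFrame

end CommonFrame

section HKSegment

variable {V : Type*} [NormedAddCommGroup V] [InnerProductSpace ℝ V]
  {I J K L : V →L[ℝ] V} {t : ℝ}

theorem endInner_lineMap_self (unit_K : endInner K K = 1) (unit_L : endInner L L = 1) (t : ℝ) :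
    endInner (AffineMap.lineMap K L t) (AffineMap.lineMap K L t) =
      (1 - t) ^ 2 + 2 * (t * (1 - t)) * endInner K L + t ^ 2 := by
  simp only [AffineMap.lineMap_apply_module, map_add, map_smul, LinearMap.add_apply,
    LinearMap.smul_apply, smul_eq_mul, unit_K, unit_L, endInner_comm L K]
  ring

theorem endInner_lineMap_self_pos (unit_K : endInner K K = 1) (unit_L : endInner L L = 1)
    (nonneg : 0 ≤ endInner K L) (ht : t ∈ Set.Icc (0 : ℝ) 1) :
    0 < endInner (AffineMap.lineMap K L t) (AffineMap.lineMap K L t) := by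
  rw [endInner_lineMap_self unit_K unit_L]
  have cross_nonneg : 0 ≤ t * (1 - t) * endInner K L :=
    mul_nonneg (mul_nonneg ht.1 (sub_nonneg.2 ht.2)) nonneg
  nlinarith [sq_nonneg (t - 1 / 2)]

namespace IsQuatPair

theorem endNormalize_right (h : IsQuatPair I J) (skew : IsSkewEnd K)
    (sq : K * K = -(endInner K K • 1)) (anticomm : I * K = -(K * I))
    (pos : 0 < endInner K K) : IsQuatPair I (endNormalize K) where
  skew_left := h.skew_left
  skew_right := skew.smul _
  sq_left := h.sq_left
  sq_right := by
    rw [endNormalize, smul_mul_smul_comm, sq, smul_neg, smul_smul, ← mul_inv,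
      Real.mul_self_sqrt pos.le, inv_mul_cancel₀ pos.ne', one_smul]
  anticomm := by
    rw [endNormalize, mul_smul_comm, smul_mul_assoc, anticomm, smul_neg]

variable [FiniteDimensional ℝ V] (hV : Module.finrank ℝ V = 8)
include hV

theorem endNormalize_lineMap (h : IsQuatPair I K) (h' : IsQuatPair I L)
    (anticommutator : K * L + L * K = (-2 * endInner K L) • 1)
    (pos : 0 < endInner (AffineMap.lineMap K L t) (AffineMap.lineMap K L t)) :
    IsQuatPair I (endNormalize (AffineMap.lineMap K L t)) := by
  refine h.endNormalize_right ?_ ?_ ?_ pos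
  · rw [AffineMap.lineMap_apply_module]
    exact (h.skew_right.smul _).add (h'.skew_right.smul _)
  · have expand : AffineMap.lineMap K L t * AffineMap.lineMap K L t =
        (1 - t) ^ 2 • (K * K) + (t * (1 - t)) • (K * L + L * K) + t ^ 2 • (L * L) := by
      simp only [AffineMap.lineMap_apply_module, add_mul, mul_add, smul_mul_assoc, mul_smul_comm]
      module
    rw [expand, anticommutator, h.sq_right, h'.sq_right, endInner_lineMap_self
      (endInner_self_of_sq hV h.sq_right) (endInner_self_of_sq hV h'.sq_right)]
    module
  · simp only [AffineMap.lineMap_apply_module, mul_add, add_mul, mul_smul_comm, smul_mul_assoc,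
      h.anticomm, h'.anticomm]
    module

end IsQuatPair

section ProjPath

variable {J J' : Fin 3 → V →L[ℝ] V}

/-- The path on the unit sphere from `K` to its normalized projection to the span of `J'`. -/
def projPath (J' : Fin 3 → V →L[ℝ] V) (K : V →L[ℝ] V) (t : ℝ) : V →L[ℝ] V :=
  endNormalize (AffineMap.lineMap K (endNormalize (hkProj J' K)) t)

theorem projPath_zero (unit : endInner K K = 1) : projPath J' K 0 = K := by
  rw [projPath, AffineMap.lineMap_apply_zero, endNormalize_of_unit unit]

theorem projPath_one (pos : 0 < endInner (hkProj J' K) (hkProj J' K)) :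
    projPath J' K 1 = endNormalize (hkProj J' K) := by
  rw [projPath, AffineMap.lineMap_apply_one, endNormalize_of_unit (endInner_endNormalize_self pos)]

namespace IsCommonFrame

variable [FiniteDimensional ℝ V] {o : Orientation ℝ V (Fin 8)} (hV : Module.finrank ℝ V = 8)
include hV

theorem endInner_normalize_hkProj_pos (c : IsCommonFrame o J J' I K) (pos : 0 < hkCosSq J J') :
    0 < endInner K (endNormalize (hkProj J' K)) := by
  rw [endInner_endNormalize_right, c.endInner_hkProj_self hV, c.endInner_hkProj_right hV]
  exact mul_pos (inv_pos.2 (Real.sqrt_pos.2 pos)) pos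

theorem endInner_lineMap_hkProj_pos (c : IsCommonFrame o J J' I K) (pos : 0 < hkCosSq J J')
    (ht : t ∈ Set.Icc (0 : ℝ) 1) :
    0 < endInner (AffineMap.lineMap K (endNormalize (hkProj J' K)) t)
      (AffineMap.lineMap K (endNormalize (hkProj J' K)) t) :=
  endInner_lineMap_self_pos c.unit (c.normalize_hkProj hV pos).unit
    (c.endInner_normalize_hkProj_pos hV pos).le ht

theorem isHKTriple_projPath (c : IsCommonFrame o J J' I K) (pos : 0 < hkCosSq J J')
    (ht : t ∈ Set.Icc (0 : ℝ) 1) : IsHKTriple o ![I, projPath J' K t, I * projPath J' K t] := by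
  have pair' := (c.normalize_hkProj hV pos).isQuatPair hV
  have orth : endInner K (I * endNormalize (hkProj J' K)) = 0 := by
    rw [endNormalize, mul_smul_comm, map_smul, c.endInner_mul_hkProj hV, smul_zero]
  have anticommutator := (c.isQuatPair hV).anticommutator_eq hV pair' orth
    (c.endInner_normalize_hkProj_pos hV pos).ne'
  exact IsHKTriple.of_isQuatPair hV
    (c.left.isHKSpan.isPosOrthComplexStructure hV c.mem_left c.unit_common)
    ((c.isQuatPair hV).endNormalize_lineMap hV pair' anticommutator
      (c.endInner_lineMap_hkProj_pos hV pos ht))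

theorem hkForm_projPath_zero (c : IsCommonFrame o J J' I K) :
    hkForm ![I, projPath J' K 0, I * projPath J' K 0] = hkForm J := by
  rw [projPath_zero c.unit, c.hkForm_eq hV]

theorem hkForm_projPath_one (c : IsCommonFrame o J J' I K) (pos : 0 < hkCosSq J J') :
    hkForm ![I, projPath J' K 1, I * projPath J' K 1] = hkForm J' := by
  rw [projPath_one (by rwa [c.endInner_hkProj_self hV]), (c.normalize_hkProj hV pos).hkForm_eq hV]

end IsCommonFrame

end ProjPath

end HKSegment

section Smooth

variable {M : Type*} [TopologicalSpace M] [ChartedSpace (EuclideanSpace ℝ (Fin 8)) M]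

theorem finrank_tangentSpace_eq (p : M) : Module.finrank ℝ (TangentSpace (𝓡 8) p) = 8 :=
  finrank_euclideanSpace_fin

variable (M) in
/-- A field of endomorphisms of the tangent spaces of `M`, without regularity. -/
abbrev EndField : Type _ := ∀ p : M, TangentSpace (𝓡 8) p →L[ℝ] TangentSpace (𝓡 8) p

theorem contMDiffOn_inv_sqrt {E H N : Type*} [NormedAddCommGroup E] [NormedSpace ℝ E]
    [TopologicalSpace H] [TopologicalSpace N] [ChartedSpace H N] {I : ModelWithCorners ℝ E H}
    {f : N → ℝ} {S : Set N} (hf : ContMDiffOn I 𝓘(ℝ, ℝ) ∞ f S) (pos : ∀ x ∈ S, 0 < f x) :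
    ContMDiffOn I 𝓘(ℝ, ℝ) ∞ (fun x => (√(f x))⁻¹) S := by
  intro x hx
  have inv_sqrt : ContDiffAt ℝ ∞ (fun y : ℝ => (√y)⁻¹) (f x) :=
    (Real.contDiffAt_sqrt (pos x hx).ne').inv (Real.sqrt_ne_zero'.2 (pos x hx))
  exact inv_sqrt.contMDiffAt.comp_contMDiffWithinAt x (hf x hx)

variable [IsManifold (𝓡 8) ∞ M] {U W : Set M}

namespace SmoothVectorFieldOn

variable {X Y : ∀ p : M, TangentSpace (𝓡 8) p}

theorem mono (hX : SmoothVectorFieldOn M U X) (h : W ⊆ U) : SmoothVectorFieldOn M W X :=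
  ContMDiffOn.mono hX h

theorem add (hX : SmoothVectorFieldOn M U X) (hY : SmoothVectorFieldOn M U Y) :
    SmoothVectorFieldOn M U (fun p => X p + Y p) :=
  ContMDiffOn.add_section (V := fun p : M => TangentSpace (𝓡 8) p) hX hY

theorem smul {f : M → ℝ} (hf : ContMDiffOn (𝓡 8) 𝓘(ℝ, ℝ) ∞ f U)
    (hX : SmoothVectorFieldOn M U X) : SmoothVectorFieldOn M U (fun p => f p • X p) :=
  ContMDiffOn.smul_section (V := fun p : M => TangentSpace (𝓡 8) p) hf hX

theorem inner [RiemannianBundle (fun p : M => TangentSpace (𝓡 8) p)]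
    [IsContMDiffRiemannianBundle (𝓡 8) ∞ (EuclideanSpace ℝ (Fin 8))
      (fun p : M => TangentSpace (𝓡 8) p)]
    (hX : SmoothVectorFieldOn M U X) (hY : SmoothVectorFieldOn M U Y) :
    ContMDiffOn (𝓡 8) 𝓘(ℝ, ℝ) ∞ (fun p => (inner ℝ (X p) (Y p) : ℝ)) U :=
  ContMDiffOn.inner_bundle (F := EuclideanSpace ℝ (Fin 8))
    (E := fun p : M => TangentSpace (𝓡 8) p) hX hY

end SmoothVectorFieldOn

/-- The field `A` of endomorphisms maps smooth vector fields to smooth vector fields. -/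
def MapsSmoothFields (U : Set M) (A : EndField M) : Prop :=
  ∀ W ⊆ U, ∀ X : ∀ p : M, TangentSpace (𝓡 8) p, SmoothVectorFieldOn M W X →
    SmoothVectorFieldOn M W (fun p => A p (X p))

theorem SmoothEndFieldOn.mapsSmoothFields {A : EndField M} (hA : SmoothEndFieldOn M U A) :
    MapsSmoothFields U A :=
  fun _ hW _ hX => ContMDiffOn.clm_bundle_apply
    (F₁ := EuclideanSpace ℝ (Fin 8)) (F₂ := EuclideanSpace ℝ (Fin 8))
    (E₁ := fun p : M => TangentSpace (𝓡 8) p) (E₂ := fun p : M => TangentSpace (𝓡 8) p)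
    (ContMDiffOn.mono hA hW) hX

namespace MapsSmoothFields

variable {A B : EndField M}

theorem mono (hA : MapsSmoothFields U A) (h : W ⊆ U) : MapsSmoothFields W A :=
  fun S hS X hX => hA S (hS.trans h) X hX

theorem add (hA : MapsSmoothFields U A) (hB : MapsSmoothFields U B) :
    MapsSmoothFields U (fun p => A p + B p) :=
  fun W hW X hX => (hA W hW X hX).add (hB W hW X hX)

theorem mul (hA : MapsSmoothFields U A) (hB : MapsSmoothFields U B) :
    MapsSmoothFields U (fun p => A p * B p) :=
  fun W hW X hX => hA W hW _ (hB W hW X hX)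

theorem smul {f : M → ℝ} (hf : ContMDiffOn (𝓡 8) 𝓘(ℝ, ℝ) ∞ f U) (hA : MapsSmoothFields U A) :
    MapsSmoothFields U (fun p => f p • A p) :=
  fun W hW X hX => SmoothVectorFieldOn.smul (hf.mono hW) (hA W hW X hX)

theorem sub (hA : MapsSmoothFields U A) (hB : MapsSmoothFields U B) :
    MapsSmoothFields U (fun p => A p - B p) := by
  simpa only [neg_one_smul, ← sub_eq_add_neg] using
    hA.add (hB.smul (f := fun _ => -1) contMDiffOn_const)

theorem sum_smul {f : Fin 3 → M → ℝ} {J : Fin 3 → EndField M}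
    (hf : ∀ i, ContMDiffOn (𝓡 8) 𝓘(ℝ, ℝ) ∞ (f i) U) (hJ : ∀ i, MapsSmoothFields U (J i)) :
    MapsSmoothFields U (fun p => ∑ i, f i p • J i p) := by
  simp only [Fin.sum_univ_three]
  exact (((hJ 0).smul (hf 0)).add ((hJ 1).smul (hf 1))).add ((hJ 2).smul (hf 2))

variable [RiemannianBundle (fun p : M => TangentSpace (𝓡 8) p)]

theorem contMDiffOn_endTrace (hU : IsOpen U) (hA : MapsSmoothFields U A) :
    ContMDiffOn (𝓡 8) 𝓘(ℝ, ℝ) ∞ (fun p => endTrace (A p)) U := by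
  refine contMDiffOn_of_locally_contMDiffOn fun p _ => ?_
  set e := trivializationAt (EuclideanSpace ℝ (Fin 8)) (fun p : M => TangentSpace (𝓡 8) p) p
  set b := (EuclideanSpace.basisFun (Fin 8) ℝ).toBasis
  refine ⟨e.baseSet, e.open_baseSet, FiberBundle.mem_baseSet_trivializationAt' p, ?_⟩
  have frame i : SmoothVectorFieldOn M (U ∩ e.baseSet) (e.localFrame b i) :=
    ContMDiffOn.mono (e.contMDiffOn_localFrame_baseSet ∞ b i) Set.inter_subset_right
  have coeff i := contMDiffOn_localFrameCoeff (I := 𝓡 8) b (hU.inter e.open_baseSet)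
    Set.inter_subset_right (hA _ Set.inter_subset_left _ (frame i)) i
  refine (contMDiffOn_finsetSum (t := Finset.univ) fun i _ => coeff i).congr fun q hq => ?_
  have hqe : q ∈ e.baseSet := hq.2
  refine (LinearMap.trace_eq_matrix_trace ℝ (e.basisAt b hqe) _).trans
    (Finset.sum_congr rfl fun i _ => ?_)
  rw [Matrix.diag_apply, LinearMap.toMatrix_apply, ← e.localFrame_apply_of_mem_baseSet b hqe]
  exact (e.localFrameCoeff_apply_of_mem_baseSet b hqe
    (fun x => A x (e.localFrame b i x)) i).symm

theorem contMDiffOn_endInner (hU : IsOpen U) (hA : MapsSmoothFields U A)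
    (hB : MapsSmoothFields U B) :
    ContMDiffOn (𝓡 8) 𝓘(ℝ, ℝ) ∞ (fun p => endInner (A p) (B p)) U :=
  ((contMDiffOn_const (c := (-1 / 8 : ℝ))).mul ((hA.mul hB).contMDiffOn_endTrace hU)).congr
    fun p _ => by rw [endInner_apply, Pi.mul_apply]; ring

theorem hkProj (hU : IsOpen U) {J : Fin 3 → EndField M} (hJ : ∀ i, MapsSmoothFields U (J i))
    (hA : MapsSmoothFields U A) :
    MapsSmoothFields U (fun p => _root_.hkProj (fun i => J i p) (A p)) := by
  simp only [hkProj_apply]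
  exact sum_smul (fun i => (hJ i).contMDiffOn_endInner hU hA) hJ

theorem endNormalize (hU : IsOpen U) (hA : MapsSmoothFields U A)
    (pos : ∀ p ∈ U, 0 < endInner (A p) (A p)) :
    MapsSmoothFields U (fun p => _root_.endNormalize (A p)) :=
  smul (contMDiffOn_inv_sqrt (hA.contMDiffOn_endInner hU hA) pos) hA

end MapsSmoothFields

end Smooth

section Families

variable {M : Type*} [TopologicalSpace M] [ChartedSpace (EuclideanSpace ℝ (Fin 8)) M]

/-- The one-parameter family `f (·, t)`, `t ∈ [0,1]`, of functions is smooth on `U × [0,1]`. -/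
abbrev SmoothFunctionFamilyOn (U : Set M) (f : M × ℝ → ℝ) : Prop :=
  ContMDiffOn ((𝓡 8).prod 𝓘(ℝ, ℝ)) 𝓘(ℝ, ℝ) ∞ f (U ×ˢ Set.Icc (0 : ℝ) 1)

variable {U : Set M}

theorem smoothFunctionFamilyOn_time : SmoothFunctionFamilyOn U (fun x => x.2) := contMDiffOn_snd

theorem smoothFunctionFamilyOn_one_sub_time : SmoothFunctionFamilyOn U (fun x => 1 - x.2) :=
  contMDiffOn_const.sub smoothFunctionFamilyOn_time

theorem SmoothFunctionFamilyOn.of_contMDiffOn {f : M → ℝ}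
    (hf : ContMDiffOn (𝓡 8) 𝓘(ℝ, ℝ) ∞ f U) : SmoothFunctionFamilyOn U (fun x => f x.1) :=
  hf.comp contMDiffOn_fst fun _ hx => hx.1

variable [IsManifold (𝓡 8) ∞ M]

namespace SmoothFormFamilyOn

variable {Ω Θ : ℝ → FourFormField M}

theorem add (hΩ : SmoothFormFamilyOn M U Ω) (hΘ : SmoothFormFamilyOn M U Θ) :
    SmoothFormFamilyOn M U (fun t p => Ω t p + Θ t p) :=
  fun W hW hWU X hX => (hΩ W hW hWU X hX).add (hΘ W hW hWU X hX)

theorem smul {f : M × ℝ → ℝ} (hf : SmoothFunctionFamilyOn U f) (hΩ : SmoothFormFamilyOn M U Ω) :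
    SmoothFormFamilyOn M U (fun t p => f (p, t) • Ω t p) :=
  fun W hW hWU X hX => (hf.mono (Set.prod_mono_left hWU)).mul (hΩ W hW hWU X hX)

end SmoothFormFamilyOn

variable [RiemannianBundle (fun p : M => TangentSpace (𝓡 8) p)]

/-- The one-parameter family `A t`, `t ∈ [0,1]`, of fields of endomorphisms is smooth on
`U × [0,1]`, in the sense that its matrix coefficients for smooth vector fields are smooth. -/
def SmoothEndFamilyOn (U : Set M) (A : ℝ → EndField M) : Prop :=
  ∀ W ⊆ U, ∀ X Y : ∀ p : M, TangentSpace (𝓡 8) p, SmoothVectorFieldOn M W X →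
    SmoothVectorFieldOn M W Y →
    SmoothFunctionFamilyOn W (fun x => inner ℝ (A x.2 x.1 (X x.1)) (Y x.1))

namespace SmoothEndFamilyOn

variable {A B : ℝ → EndField M}

theorem add (hA : SmoothEndFamilyOn U A) (hB : SmoothEndFamilyOn U B) :
    SmoothEndFamilyOn U (fun t p => A t p + B t p) := fun W hW X Y hX hY =>
  ((hA W hW X Y hX hY).add (hB W hW X Y hX hY)).congr fun _ _ => inner_add_left _ _ _

theorem smul {f : M × ℝ → ℝ} (hf : SmoothFunctionFamilyOn U f) (hA : SmoothEndFamilyOn U A) :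
    SmoothEndFamilyOn U (fun t p => f (p, t) • A t p) :=
  fun W hW X Y hX hY =>
    ((hf.mono (Set.prod_mono_left hW)).mul (hA W hW X Y hX hY)).congr
      fun _ _ => real_inner_smul_left _ _ _

theorem kahlerSq (skew : ∀ t ∈ Set.Icc (0 : ℝ) 1, ∀ p ∈ U, IsSkewEnd (A t p))
    (hA : SmoothEndFamilyOn U A) : SmoothFormFamilyOn M U (fun t p => _root_.kahlerSq (A t p)) := by
  intro W _ hWU X hX
  have coeff k l := hA W hWU (X k) (X l) (hX k) (hX l)
  exact (contMDiffOn_const.mul ((((coeff 0 1).mul (coeff 2 3)).sub ((coeff 0 2).mul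
    (coeff 1 3))).add ((coeff 0 3).mul (coeff 1 2)))).congr fun x hx =>
      (skew x.2 hx.2 x.1 (hWU hx.1)).kahlerSq_apply _

theorem hkForm {J : Fin 3 → ℝ → EndField M}
    (skew : ∀ i, ∀ t ∈ Set.Icc (0 : ℝ) 1, ∀ p ∈ U, IsSkewEnd (J i t p))
    (hJ : ∀ i, SmoothEndFamilyOn U (J i)) :
    SmoothFormFamilyOn M U (fun t p => _root_.hkForm (fun i => J i t p)) := by
  have sq i := (hJ i).kahlerSq (skew i)
  simp only [_root_.hkForm, Fin.sum_univ_three]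
  exact .smul (f := fun _ => 1 / 6) contMDiffOn_const (((sq 0).add (sq 1)).add (sq 2))

end SmoothEndFamilyOn

namespace MapsSmoothFields

variable {A B : EndField M}

theorem contMDiffOn_formInner_kahlerSq (hU : IsOpen U) (hA : MapsSmoothFields U A)
    (hB : MapsSmoothFields U B) (skew_A : ∀ p ∈ U, IsSkewEnd (A p))
    (skew_B : ∀ p ∈ U, IsSkewEnd (B p)) :
    ContMDiffOn (𝓡 8) 𝓘(ℝ, ℝ) ∞ (fun p => formInner (kahlerSq (A p)) (kahlerSq (B p))) U :=
  (((contMDiffOn_const (c := (1 / 2 : ℝ))).mul (((hA.mul hB).contMDiffOn_endTrace hU).pow 2)).sub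
    (((hA.mul hB).mul (hA.mul hB)).contMDiffOn_endTrace hU)).congr
      fun p hp => formInner_kahlerSq (skew_A p hp) (skew_B p hp)

theorem contMDiffOn_formInner_hkForm (hU : IsOpen U) {J J' : Fin 3 → EndField M}
    (hJ : ∀ i, MapsSmoothFields U (J i)) (hJ' : ∀ i, MapsSmoothFields U (J' i))
    (skew : ∀ i, ∀ p ∈ U, IsSkewEnd (J i p)) (skew' : ∀ i, ∀ p ∈ U, IsSkewEnd (J' i p)) :
    ContMDiffOn (𝓡 8) 𝓘(ℝ, ℝ) ∞
      (fun p => formInner (hkForm fun i => J i p) (hkForm fun i => J' i p)) U := by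
  simp only [formInner_hkForm]
  exact contMDiffOn_const.mul (contMDiffOn_finsetSum fun i _ => contMDiffOn_finsetSum fun j _ =>
    (hJ i).contMDiffOn_formInner_kahlerSq hU (hJ' j) (skew i) (skew' j))

variable [IsContMDiffRiemannianBundle (𝓡 8) ∞ (EuclideanSpace ℝ (Fin 8))
    (fun p : M => TangentSpace (𝓡 8) p)]

theorem smoothEndFamilyOn (hA : MapsSmoothFields U A) : SmoothEndFamilyOn U (fun _ => A) :=
  fun _ hW _ _ hX hY => .of_contMDiffOn ((hA _ hW _ hX).inner hY)

theorem smoothEndFamilyOn_lineMap (hA : MapsSmoothFields U A) (hB : MapsSmoothFields U B) :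
    SmoothEndFamilyOn U (fun t p => AffineMap.lineMap (A p) (B p) t) := by
  simp only [AffineMap.lineMap_apply_module]
  exact (SmoothEndFamilyOn.smul (A := fun _ => A) (f := fun x => 1 - x.2)
    smoothFunctionFamilyOn_one_sub_time hA.smoothEndFamilyOn).add
      (SmoothEndFamilyOn.smul (A := fun _ => B) (f := fun x => x.2) smoothFunctionFamilyOn_time
        hB.smoothEndFamilyOn)

end MapsSmoothFields

end Families

section LocalTriple

variable {M : Type*} [TopologicalSpace M] [ChartedSpace (EuclideanSpace ℝ (Fin 8)) M]
  [IsManifold (𝓡 8) ∞ M] [RiemannianBundle (fun p : M => TangentSpace (𝓡 8) p)]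
  {o : ManifoldOrientation M}

namespace AQHStructure

/-- `J` is a smooth field on `U` of hyper-Kähler triples spanning the bundle of `Q`. -/
structure IsLocalTriple (Q : AQHStructure o) (U : Set M) (J : Fin 3 → EndField M) : Prop where
  smooth : ∀ i, MapsSmoothFields U (J i)
  isHKTriple : ∀ p ∈ U, IsHKTriple (o.or p) (fun i => J i p)
  span_eq : ∀ p ∈ U, Q.E p = Submodule.span ℝ (Set.range fun i => J i p)

theorem exists_isLocalTriple (Q : AQHStructure o) (p₀ : M) :
    ∃ U : Set M, IsOpen U ∧ p₀ ∈ U ∧ ∃ J, Q.IsLocalTriple U J := by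
  obtain ⟨U, hU, hp₀, J, hJ, h⟩ := Q.exists_local_triple p₀
  exact ⟨U, hU, hp₀, J, fun i => (hJ i).mapsSmoothFields, fun p hp => (h p hp).1,
    fun p hp => (h p hp).2⟩

namespace IsLocalTriple

variable {Q : AQHStructure o} {U W : Set M} {J : Fin 3 → EndField M}

theorem mono (h : Q.IsLocalTriple U J) (hW : W ⊆ U) : Q.IsLocalTriple W J :=
  ⟨fun i => (h.smooth i).mono hW, fun p hp => h.isHKTriple p (hW hp),
    fun p hp => h.span_eq p (hW hp)⟩

theorem fundamentalForm_eq (h : Q.IsLocalTriple U J) {p : M} (hp : p ∈ U) :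
    Q.fundamentalForm p = hkForm fun i => J i p :=
  Q.fundamentalForm_eq p (h.isHKTriple p hp) (h.span_eq p hp)

theorem skew (h : Q.IsLocalTriple U J) (i : Fin 3) : ∀ p ∈ U, IsSkewEnd (J i p) :=
  fun p hp => ((h.isHKTriple p hp).complex i).skew

theorem exists_smooth_extension (h : Q.IsLocalTriple U J) {p₀ : M} (hp₀ : p₀ ∈ U)
    {A : TangentSpace (𝓡 8) p₀ →L[ℝ] TangentSpace (𝓡 8) p₀} (hA : A ∈ Q.E p₀) :
    ∃ α : EndField M, MapsSmoothFields U α ∧ α p₀ = A ∧ ∀ p ∈ U, α p ∈ Q.E p := by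
  rw [h.span_eq p₀ hp₀, Submodule.mem_span_range_iff_exists_fun] at hA
  obtain ⟨a, rfl⟩ := hA
  refine ⟨fun p => ∑ i, a i • J i p, .sum_smul (fun _ => contMDiffOn_const) h.smooth, rfl,
    fun p hp => ?_⟩
  rw [h.span_eq p hp]
  exact Submodule.sum_smul_mem _ _ fun i _ => Submodule.subset_span ⟨i, rfl⟩

end IsLocalTriple

theorem contMDiffOn_formInner_fundamentalForm (Q₀ Q₁ : AQHStructure o) :
    ContMDiffOn (𝓡 8) 𝓘(ℝ, ℝ) ∞
      (fun p => formInner (Q₀.fundamentalForm p) (Q₁.fundamentalForm p)) Set.univ := by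
  refine contMDiffOn_of_locally_contMDiffOn fun p _ => ?_
  obtain ⟨U₀, hU₀, hp₀, J, h⟩ := Q₀.exists_isLocalTriple p
  obtain ⟨U₁, hU₁, hp₁, J', h'⟩ := Q₁.exists_isLocalTriple p
  replace h := h.mono (W := U₀ ∩ U₁) Set.inter_subset_left
  replace h' := h'.mono (W := U₀ ∩ U₁) Set.inter_subset_right
  have smooth := MapsSmoothFields.contMDiffOn_formInner_hkForm (hU₀.inter hU₁) h.smooth h'.smooth
    h.skew h'.skew
  refine ⟨U₀ ∩ U₁, hU₀.inter hU₁, ⟨hp₀, hp₁⟩, ?_⟩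
  rw [Set.univ_inter]
  exact smooth.congr fun q hq => by rw [h.fundamentalForm_eq hq, h'.fundamentalForm_eq hq]

theorem IsLocalTriple.contMDiffOn_hkCosSq {Q₀ Q₁ : AQHStructure o} {U : Set M}
    {J J' : Fin 3 → EndField M} (h : Q₀.IsLocalTriple U J) (h' : Q₁.IsLocalTriple U J') :
    ContMDiffOn (𝓡 8) 𝓘(ℝ, ℝ) ∞ (fun p => hkCosSq (fun i => J i p) (fun i => J' i p)) U := by
  have smooth := (contMDiffOn_formInner_fundamentalForm Q₀ Q₁).mono (Set.subset_univ U)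
  refine (((contMDiffOn_const (c := (9 : ℝ))).mul smooth).sub
    (contMDiffOn_const (c := (14 : ℝ)))).div_const 16 |>.congr fun p hp => ?_
  rw [hkCosSq, ← h.fundamentalForm_eq hp, ← h'.fundamentalForm_eq hp]
  rfl

theorem smoothFormFamilyOn_fundamentalForm (Q : AQHStructure o)
    [IsContMDiffRiemannianBundle (𝓡 8) ∞ (EuclideanSpace ℝ (Fin 8))
      (fun p : M => TangentSpace (𝓡 8) p)] :
    SmoothFormFamilyOn M Set.univ (fun _ => Q.fundamentalForm) := by
  intro W hW _ X hX
  refine contMDiffOn_of_locally_contMDiffOn fun x _ => ?_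
  obtain ⟨U, hU, hp, J, h⟩ := Q.exists_isLocalTriple x.1
  have smooth := SmoothEndFamilyOn.hkForm (J := fun i _ => J i) (fun i _ _ => h.skew i)
    (fun i => (h.smooth i).smoothEndFamilyOn) (W ∩ U) (hW.inter hU) Set.inter_subset_right X
    fun i => (hX i).mono Set.inter_subset_left
  refine ⟨U ×ˢ Set.univ, hU.prod isOpen_univ, ⟨hp, trivial⟩, ?_⟩
  rw [Set.prod_inter_prod, Set.inter_univ]
  exact smooth.congr fun y hy =>
    congrArg (fun Ω => Ω fun i => X i y.1) (h.fundamentalForm_eq hy.1.2)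

end AQHStructure

end LocalTriple

section SelfDualHomotopy

theorem IsHKTriple.formInner_self {V : Type*} [NormedAddCommGroup V] [InnerProductSpace ℝ V]
    [FiniteDimensional ℝ V] {o : Orientation ℝ V (Fin 8)} {J : Fin 3 → V →L[ℝ] V}
    (hV : Module.finrank ℝ V = 8) (h : IsHKTriple o J) :
    formInner (hkForm J) (hkForm J) = 10 / 3 := by
  have unit : endInner (J 1) (J 1) = 1 := h.endInner_eq hV 1 1
  have orth : endInner (J 1) (J 0 * J 1) = 0 := h.eq_mul ▸ h.endInner_eq hV 1 2
  rw [h.eq_cons, formInner_hkForm_of_common hV h.isQuatPair h.isQuatPair, unit, orth]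
  norm_num

variable {M : Type*} [TopologicalSpace M] [ChartedSpace (EuclideanSpace ℝ (Fin 8)) M]
  [IsManifold (𝓡 8) ∞ M] [RiemannianBundle (fun p : M => TangentSpace (𝓡 8) p)]
  {o : ManifoldOrientation M}

namespace AQHStructure

theorem formInner_fundamentalForm_self (Q : AQHStructure o) (p : M) :
    formInner (Q.fundamentalForm p) (Q.fundamentalForm p) = 10 / 3 := by
  obtain ⟨J, h, hJ⟩ := Q.exists_triple p
  rw [Q.fundamentalForm_eq p h hJ, h.formInner_self (finrank_tangentSpace_eq p)]

theorem isSelfDual_fundamentalForm (Q : AQHStructure o) (p : M) :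
    IsSelfDual (o.or p) (Q.fundamentalForm p) := by
  obtain ⟨J, h, hJ⟩ := Q.exists_triple p
  rw [Q.fundamentalForm_eq p h hJ]
  exact h.isSelfDual_hkForm (finrank_tangentSpace_eq p)

theorem formInner_fundamentalForm_nonneg {Q₀ Q₁ : AQHStructure o} {p : M}
    (hd : 1 ≤ Module.finrank ℝ ↥(Q₀.E p ⊓ Q₁.E p)) :
    0 ≤ formInner (Q₀.fundamentalForm p) (Q₁.fundamentalForm p) := by
  obtain ⟨J, h, hJ⟩ := Q₀.exists_triple p
  obtain ⟨J', h', hJ'⟩ := Q₁.exists_triple p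
  rw [hJ, hJ'] at hd
  obtain ⟨I, K, c⟩ := h.exists_isCommonFrame (finrank_tangentSpace_eq p) h' hd
  have cos_sq_nonneg := c.hkCosSq_nonneg (finrank_tangentSpace_eq p)
  rw [hkCosSq] at cos_sq_nonneg
  rw [Q₀.fundamentalForm_eq p h hJ, Q₁.fundamentalForm_eq p h' hJ']
  linarith

/-- The affine segment from the fundamental form of `Q₀` to that of `Q₁`. -/
def segment (Q₀ Q₁ : AQHStructure o) (t : ℝ) : FourFormField M :=
  fun p => (1 - t) • Q₀.fundamentalForm p + t • Q₁.fundamentalForm p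

theorem formInner_segment_self (Q₀ Q₁ : AQHStructure o) (t : ℝ) (p : M) :
    formInner (Q₀.segment Q₁ t p) (Q₀.segment Q₁ t p) =
      10 / 3 * ((1 - t) ^ 2 + t ^ 2) +
        2 * (t * (1 - t)) * formInner (Q₀.fundamentalForm p) (Q₁.fundamentalForm p) := by
  simp only [segment, formInner_add_left, formInner_add_right, formInner_smul_left,
    formInner_smul_right, formInner_fundamentalForm_self,
    formInner_comm (Q₁.fundamentalForm p) (Q₀.fundamentalForm p)]
  ring

theorem formInner_segment_self_pos {Q₀ Q₁ : AQHStructure o} {t : ℝ} {p : M}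
    (hd : 1 ≤ Module.finrank ℝ ↥(Q₀.E p ⊓ Q₁.E p)) (ht : t ∈ Set.Icc (0 : ℝ) 1) :
    0 < formInner (Q₀.segment Q₁ t p) (Q₀.segment Q₁ t p) := by
  have cross_nonneg := mul_nonneg (mul_nonneg zero_le_two (mul_nonneg ht.1 (sub_nonneg.2 ht.2)))
    (formInner_fundamentalForm_nonneg hd)
  rw [formInner_segment_self]
  nlinarith [sq_nonneg (t - 1 / 2)]

/-- The segment from the fundamental form of `Q₀` to that of `Q₁`, rescaled to squared norm
`10 / 3`. -/
def normalizedSegment (Q₀ Q₁ : AQHStructure o) (t : ℝ) : FourFormField M := fun p =>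
  (√(10 / 3) * (√(formInner (Q₀.segment Q₁ t p) (Q₀.segment Q₁ t p)))⁻¹) • Q₀.segment Q₁ t p

theorem normalizedSegment_zero (Q₀ Q₁ : AQHStructure o) :
    Q₀.normalizedSegment Q₁ 0 = Q₀.fundamentalForm := by
  funext p
  rw [normalizedSegment, formInner_segment_self]
  simp [segment]

theorem normalizedSegment_one (Q₀ Q₁ : AQHStructure o) :
    Q₀.normalizedSegment Q₁ 1 = Q₁.fundamentalForm := by
  funext p
  rw [normalizedSegment, formInner_segment_self]
  simp [segment]

theorem isSelfDual_normalizedSegment (Q₀ Q₁ : AQHStructure o) (t : ℝ) (p : M) :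
    IsSelfDual (o.or p) (Q₀.normalizedSegment Q₁ t p) :=
  (((Q₀.isSelfDual_fundamentalForm p).smul _).add
    ((Q₁.isSelfDual_fundamentalForm p).smul _)).smul _

theorem formInner_normalizedSegment_self {Q₀ Q₁ : AQHStructure o} {t : ℝ} {p : M}
    (hd : 1 ≤ Module.finrank ℝ ↥(Q₀.E p ⊓ Q₁.E p)) (ht : t ∈ Set.Icc (0 : ℝ) 1) :
    formInner (Q₀.normalizedSegment Q₁ t p) (Q₀.normalizedSegment Q₁ t p) = 10 / 3 := by
  have pos := formInner_segment_self_pos hd ht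
  rw [normalizedSegment, formInner_smul_left, formInner_smul_right]
  generalize formInner (Q₀.segment Q₁ t p) (Q₀.segment Q₁ t p) = n at pos ⊢
  have sqrt_ne_zero := Real.sqrt_ne_zero'.2 pos
  field_simp
  rw [Real.sq_sqrt (by norm_num), Real.sq_sqrt pos.le]
  ring

theorem smoothFunctionFamilyOn_formInner_segment_self (Q₀ Q₁ : AQHStructure o) :
    SmoothFunctionFamilyOn Set.univ
      (fun x => formInner (Q₀.segment Q₁ x.2 x.1) (Q₀.segment Q₁ x.2 x.1)) := by
  have time := smoothFunctionFamilyOn_time (U := (Set.univ : Set M))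
  have one_sub_time := smoothFunctionFamilyOn_one_sub_time (U := (Set.univ : Set M))
  have inner : SmoothFunctionFamilyOn Set.univ _ :=
    .of_contMDiffOn (contMDiffOn_formInner_fundamentalForm Q₀ Q₁)
  exact ((contMDiffOn_const.mul ((one_sub_time.pow 2).add (time.pow 2))).add
    ((contMDiffOn_const.mul (time.mul one_sub_time)).mul inner)).congr
      fun x _ => formInner_segment_self Q₀ Q₁ x.2 x.1

variable [IsContMDiffRiemannianBundle (𝓡 8) ∞ (EuclideanSpace ℝ (Fin 8))
    (fun p : M => TangentSpace (𝓡 8) p)]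

theorem smoothFormFamilyOn_segment (Q₀ Q₁ : AQHStructure o) :
    SmoothFormFamilyOn M Set.univ (Q₀.segment Q₁) :=
  (Q₀.smoothFormFamilyOn_fundamentalForm.smul smoothFunctionFamilyOn_one_sub_time).add
    (Q₁.smoothFormFamilyOn_fundamentalForm.smul smoothFunctionFamilyOn_time)

theorem smoothFormFamilyOn_normalizedSegment {Q₀ Q₁ : AQHStructure o}
    (hd : ∀ p, 1 ≤ Module.finrank ℝ ↥(Q₀.E p ⊓ Q₁.E p)) :
    SmoothFormFamilyOn M Set.univ (Q₀.normalizedSegment Q₁) :=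
  (smoothFormFamilyOn_segment Q₀ Q₁).smul (contMDiffOn_const.mul
    (contMDiffOn_inv_sqrt (smoothFunctionFamilyOn_formInner_segment_self Q₀ Q₁)
      fun x hx => formInner_segment_self_pos (hd x.1) hx.2))

end AQHStructure

end SelfDualHomotopy

section LocalFrame

variable {M : Type*} [TopologicalSpace M] [ChartedSpace (EuclideanSpace ℝ (Fin 8)) M]
  [IsManifold (𝓡 8) ∞ M] [RiemannianBundle (fun p : M => TangentSpace (𝓡 8) p)] {U : Set M}
  {p₀ : M}

theorem MapsSmoothFields.exists_endNormalize {A : EndField M} (hU : IsOpen U) (hp₀ : p₀ ∈ U)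
    (hA : MapsSmoothFields U A) (pos : 0 < endInner (A p₀) (A p₀)) :
    ∃ W ⊆ U, IsOpen W ∧ p₀ ∈ W ∧ MapsSmoothFields W (fun p => _root_.endNormalize (A p)) ∧
      ∀ p ∈ W, endInner (_root_.endNormalize (A p)) (_root_.endNormalize (A p)) = 1 := by
  have continuousOn := (hA.contMDiffOn_endInner hU hA).continuousOn
  have isOpen_pos : IsOpen (U ∩ {p | 0 < endInner (A p) (A p)}) :=
    continuousOn.isOpen_inter_preimage hU isOpen_Ioi
  exact ⟨_, Set.inter_subset_left, isOpen_pos, ⟨hp₀, pos⟩,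
    (hA.mono Set.inter_subset_left).endNormalize isOpen_pos fun _ hp => hp.2,
    fun _ hp => endInner_endNormalize_self hp.2⟩

variable {o : ManifoldOrientation M}

namespace AQHStructure

namespace IsLocalTriple

variable {Q Q₀ Q₁ : AQHStructure o} {J J' : Fin 3 → EndField M}

theorem exists_isCommonFrame (h : Q₀.IsLocalTriple U J) (h' : Q₁.IsLocalTriple U J') {p : M}
    (hp : p ∈ U) (hd : Module.finrank ℝ ↥(Q₀.E p ⊓ Q₁.E p) = 1) :
    ∃ I K, IsCommonFrame (o.or p) (fun i => J i p) (fun i => J' i p) I K := by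
  rw [h.span_eq p hp, h'.span_eq p hp] at hd
  exact (h.isHKTriple p hp).exists_isCommonFrame (finrank_tangentSpace_eq p)
    (h'.isHKTriple p hp) hd.ge

-- On `E₀`, the operator `P₀ P₁ - c²` is `(1 - c²) ⟨I, ·⟩ I` for a common unit `I`: its values
-- are multiples of `I` that depend smoothly on the point.
theorem exists_smooth_common_unit (hU : IsOpen U) (hp₀ : p₀ ∈ U) (h : Q₀.IsLocalTriple U J)
    (h' : Q₁.IsLocalTriple U J') (hd : ∀ p, Module.finrank ℝ ↥(Q₀.E p ⊓ Q₁.E p) = 1) :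
    ∃ W ⊆ U, IsOpen W ∧ p₀ ∈ W ∧ ∃ I : EndField M, MapsSmoothFields W I ∧
      ∀ p ∈ W, I p ∈ Q₀.E p ⊓ Q₁.E p ∧ endInner (I p) (I p) = 1 := by
  have hV := finrank_tangentSpace_eq p₀
  obtain ⟨I₀, K₀, c₀⟩ := h.exists_isCommonFrame h' hp₀ (hd p₀)
  obtain ⟨α, smooth_α, α_p₀, mem_α⟩ := h.exists_smooth_extension hp₀
    (h.span_eq p₀ hp₀ ▸ c₀.mem_left)
  let δ : EndField M := fun p => hkProj (fun i => J i p) (hkProj (fun i => J' i p) (α p)) -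
    hkCosSq (fun i => J i p) (fun i => J' i p) • α p
  have smooth_δ : MapsSmoothFields U δ := ((smooth_α.hkProj hU h'.smooth).hkProj hU h.smooth).sub
    (smooth_α.smul (h.contMDiffOn_hkCosSq h'))
  have mem_δ p (hp : p ∈ U) : δ p ∈ Q₀.E p ⊓ Q₁.E p := by
    obtain ⟨I, K, c⟩ := h.exists_isCommonFrame h' hp (hd p)
    rw [h.span_eq p hp, h'.span_eq p hp]
    exact c.hkProj_hkProj_sub_mem (finrank_tangentSpace_eq p) (h.span_eq p hp ▸ mem_α p hp)
  have pos : 0 < endInner (δ p₀) (δ p₀) := by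
    have cos_ne_one := c₀.hkCosSq_ne_one hV (h.span_eq p₀ hp₀ ▸ h'.span_eq p₀ hp₀ ▸ hd p₀)
    simp only [δ, α_p₀, c₀.hkProj_hkProj_sub hV c₀.mem_left, map_smul, LinearMap.smul_apply,
      c₀.unit_common, smul_eq_mul, mul_one]
    exact mul_self_pos.2 (sub_ne_zero.2 cos_ne_one.symm)
  obtain ⟨W, hW, isOpen_W, hp₀W, smooth, unit⟩ := smooth_δ.exists_endNormalize hU hp₀ pos
  exact ⟨W, hW, isOpen_W, hp₀W, _, smooth, fun p hp =>
    ⟨Submodule.smul_mem _ _ (mem_δ p (hW hp)), unit p hp⟩⟩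

theorem exists_smooth_orthogonal_unit (hU : IsOpen U) (hp₀ : p₀ ∈ U) (h : Q.IsLocalTriple U J)
    {I : EndField M} (smooth_I : MapsSmoothFields U I) (mem_I : ∀ p ∈ U, I p ∈ Q.E p)
    (unit_I : ∀ p ∈ U, endInner (I p) (I p) = 1) :
    ∃ W ⊆ U, IsOpen W ∧ p₀ ∈ W ∧ ∃ K : EndField M, MapsSmoothFields W K ∧
      ∀ p ∈ W, K p ∈ Q.E p ∧ endInner (K p) (K p) = 1 ∧ endInner (I p) (K p) = 0 := by
  obtain ⟨K₀, mem_K₀, unit_K₀, orth_K₀, -⟩ := (h.isHKTriple p₀ hp₀).isHKSpan.exists_unit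
    (finrank_tangentSpace_eq p₀) (I p₀) (I p₀)
  obtain ⟨β, smooth_β, β_p₀, mem_β⟩ := h.exists_smooth_extension hp₀
    (h.span_eq p₀ hp₀ ▸ mem_K₀)
  let κ : EndField M := fun p => β p - endInner (I p) (β p) • I p
  have smooth_κ : MapsSmoothFields U κ :=
    smooth_β.sub (smooth_I.smul (smooth_I.contMDiffOn_endInner hU smooth_β))
  have orth_κ p (hp : p ∈ U) : endInner (I p) (κ p) = 0 := by
    simp only [κ, map_sub, map_smul, unit_I p hp, smul_eq_mul, mul_one, sub_self]
  have κ_p₀ : κ p₀ = K₀ := by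
    simp only [κ, β_p₀, endInner_comm (I p₀), orth_K₀, zero_smul, sub_zero]
  obtain ⟨W, hW, isOpen_W, hp₀W, smooth, unit⟩ := smooth_κ.exists_endNormalize hU hp₀
    (by rw [κ_p₀, unit_K₀]; exact one_pos)
  refine ⟨W, hW, isOpen_W, hp₀W, _, smooth, fun p hp => ⟨?_, unit p hp, ?_⟩⟩
  · exact Submodule.smul_mem _ _
      (Submodule.sub_mem _ (mem_β p (hW hp)) (Submodule.smul_mem _ _ (mem_I p (hW hp))))
  · rw [endInner_endNormalize_right, orth_κ p (hW hp), mul_zero]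

end IsLocalTriple

/-- Spanning triples `J`, `J'` of `Q₀`, `Q₁` together with a frame adapted to the common part of
their bundles, all smooth on `U`. -/
structure IsLocalCommonFrame (Q₀ Q₁ : AQHStructure o) (U : Set M) (J J' : Fin 3 → EndField M)
    (I K : EndField M) : Prop where
  left : Q₀.IsLocalTriple U J
  right : Q₁.IsLocalTriple U J'
  smooth_common : MapsSmoothFields U I
  smooth : MapsSmoothFields U K
  isCommonFrame : ∀ p ∈ U, IsCommonFrame (o.or p) (fun i => J i p) (fun i => J' i p) (I p) (K p)

theorem exists_isLocalCommonFrame {Q₀ Q₁ : AQHStructure o}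
    (hd : ∀ p, Module.finrank ℝ ↥(Q₀.E p ⊓ Q₁.E p) = 1) (p₀ : M) :
    ∃ U : Set M, IsOpen U ∧ p₀ ∈ U ∧ ∃ J J' I K, IsLocalCommonFrame Q₀ Q₁ U J J' I K := by
  obtain ⟨U₀, hU₀, hp₀, J, h⟩ := Q₀.exists_isLocalTriple p₀
  obtain ⟨U₁, hU₁, hp₁, J', h'⟩ := Q₁.exists_isLocalTriple p₀
  obtain ⟨W, hW, isOpen_W, hp₀W, I, smooth_I, hI⟩ :=
    (h.mono Set.inter_subset_left).exists_smooth_common_unit (hU₀.inter hU₁) ⟨hp₀, hp₁⟩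
      (h'.mono Set.inter_subset_right) hd
  replace h := h.mono fun p hp => (hW hp).1
  replace h' := h'.mono fun p hp => (hW hp).2
  obtain ⟨U, hU, isOpen_U, hp₀U, K, smooth_K, hK⟩ :=
    h.exists_smooth_orthogonal_unit isOpen_W hp₀W smooth_I (fun p hp => (hI p hp).1.1)
      fun p hp => (hI p hp).2
  replace h := h.mono hU
  replace h' := h'.mono hU
  refine ⟨U, isOpen_U, hp₀U, J, J', I, K, h, h', smooth_I.mono hU, smooth_K, fun p hp => ?_⟩
  obtain ⟨⟨mem_left, mem_right⟩, unit_common⟩ := hI p (hU hp)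
  obtain ⟨mem, unit, orth⟩ := hK p hp
  rw [h.span_eq p hp] at mem_left mem
  exact ⟨h.isHKTriple p hp, h'.isHKTriple p hp, mem_left, h'.span_eq p hp ▸ mem_right, mem,
    unit_common, unit, orth⟩

end AQHStructure

end LocalFrame

section LocalHomotopy

variable {M : Type*} [TopologicalSpace M] [ChartedSpace (EuclideanSpace ℝ (Fin 8)) M]
  [IsManifold (𝓡 8) ∞ M] [RiemannianBundle (fun p : M => TangentSpace (𝓡 8) p)]
  {o : ManifoldOrientation M} {U : Set M}

theorem AQHStructure.IsLocalTriple.hkCosSq_pos {Q₀ Q₁ : AQHStructure o} {J J' : Fin 3 → EndField M}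
    (h : Q₀.IsLocalTriple U J) (h' : Q₁.IsLocalTriple U J') {p : M} (hp : p ∈ U)
    (hc : 7 / 15 < Real.cos (Q₀.angle Q₁ p)) :
    0 < hkCosSq (fun i => J i p) (fun i => J' i p) := by
  rw [angle, h.fundamentalForm_eq hp, h'.fundamentalForm_eq hp] at hc
  rw [hkCosSq]
  set x := formInner (hkForm fun i => J i p) (hkForm fun i => J' i p)
  rcases le_or_gt (3 / 10 * x) (-1) with le_neg_one | gt_neg_one
  · rw [Real.arccos_of_le_neg_one le_neg_one, Real.cos_pi] at hc
    norm_num at hc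
  rcases le_or_gt (3 / 10 * x) 1 with le_one | gt_one
  · rw [Real.cos_arccos gt_neg_one.le le_one] at hc
    linarith
  · linarith

namespace MapsSmoothFields

variable {I K L : EndField M}

theorem smoothFunctionFamilyOn_inv_norm_lineMap (hU : IsOpen U) (hK : MapsSmoothFields U K)
    (hL : MapsSmoothFields U L) (unit_K : ∀ p ∈ U, endInner (K p) (K p) = 1)
    (unit_L : ∀ p ∈ U, endInner (L p) (L p) = 1) (nonneg : ∀ p ∈ U, 0 ≤ endInner (K p) (L p)) :
    SmoothFunctionFamilyOn U (fun x =>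
      (√(endInner (AffineMap.lineMap (K x.1) (L x.1) x.2)
        (AffineMap.lineMap (K x.1) (L x.1) x.2)))⁻¹) := by
  have time := smoothFunctionFamilyOn_time (U := U)
  have one_sub_time := smoothFunctionFamilyOn_one_sub_time (U := U)
  have inner : SmoothFunctionFamilyOn U _ := .of_contMDiffOn (hK.contMDiffOn_endInner hU hL)
  refine contMDiffOn_inv_sqrt ?_ fun x hx =>
    endInner_lineMap_self_pos (unit_K x.1 hx.1) (unit_L x.1 hx.1) (nonneg x.1 hx.1) hx.2
  exact (((one_sub_time.pow 2).add ((contMDiffOn_const.mul (time.mul one_sub_time)).mul inner)).add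
    (time.pow 2)).congr fun x hx => endInner_lineMap_self (unit_K x.1 hx.1) (unit_L x.1 hx.1) x.2

variable [IsContMDiffRiemannianBundle (𝓡 8) ∞ (EuclideanSpace ℝ (Fin 8))
    (fun p : M => TangentSpace (𝓡 8) p)]

theorem smoothEndFamilyOn_normalize_lineMap (hU : IsOpen U) (hK : MapsSmoothFields U K)
    (hL : MapsSmoothFields U L) (unit_K : ∀ p ∈ U, endInner (K p) (K p) = 1)
    (unit_L : ∀ p ∈ U, endInner (L p) (L p) = 1) (nonneg : ∀ p ∈ U, 0 ≤ endInner (K p) (L p)) :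
    SmoothEndFamilyOn U (fun t p => _root_.endNormalize (AffineMap.lineMap (K p) (L p) t)) :=
  .smul (A := fun t p => AffineMap.lineMap (K p) (L p) t)
    (hK.smoothFunctionFamilyOn_inv_norm_lineMap hU hL unit_K unit_L nonneg)
    (hK.smoothEndFamilyOn_lineMap hL)

theorem smoothEndFamilyOn_mul_normalize_lineMap (hU : IsOpen U) (hI : MapsSmoothFields U I)
    (hK : MapsSmoothFields U K) (hL : MapsSmoothFields U L)
    (unit_K : ∀ p ∈ U, endInner (K p) (K p) = 1) (unit_L : ∀ p ∈ U, endInner (L p) (L p) = 1)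
    (nonneg : ∀ p ∈ U, 0 ≤ endInner (K p) (L p)) :
    SmoothEndFamilyOn U
      (fun t p => I p * _root_.endNormalize (AffineMap.lineMap (K p) (L p) t)) := by
  have mul_eq (t : ℝ) (p : M) : I p * _root_.endNormalize (AffineMap.lineMap (K p) (L p) t) =
      (√(endInner (AffineMap.lineMap (K p) (L p) t)
        (AffineMap.lineMap (K p) (L p) t)))⁻¹ •
          AffineMap.lineMap (I p * K p) (I p * L p) t := by
    simp only [_root_.endNormalize, AffineMap.lineMap_apply_module, mul_smul_comm, mul_add]
  simp only [mul_eq]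
  exact .smul (A := fun t p => AffineMap.lineMap (I p * K p) (I p * L p) t)
    (hK.smoothFunctionFamilyOn_inv_norm_lineMap hU hL unit_K unit_L nonneg)
    ((hI.mul hK).smoothEndFamilyOn_lineMap (hI.mul hL))

end MapsSmoothFields

namespace AQHStructure.IsLocalCommonFrame

variable {Q₀ Q₁ : AQHStructure o} {J J' : Fin 3 → EndField M} {I K : EndField M}

theorem smooth_endNormalize_hkProj (c : IsLocalCommonFrame Q₀ Q₁ U J J' I K) (hU : IsOpen U)
    (pos : ∀ p ∈ U, 0 < hkCosSq (fun i => J i p) (fun i => J' i p)) :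
    MapsSmoothFields U (fun p => endNormalize (hkProj (fun i => J' i p) (K p))) :=
  (c.smooth.hkProj hU c.right.smooth).endNormalize hU fun p hp => by
    rw [(c.isCommonFrame p hp).endInner_hkProj_self (finrank_tangentSpace_eq p)]
    exact pos p hp

variable [IsContMDiffRiemannianBundle (𝓡 8) ∞ (EuclideanSpace ℝ (Fin 8))
    (fun p : M => TangentSpace (𝓡 8) p)]

theorem smoothFormFamilyOn_projPath (c : IsLocalCommonFrame Q₀ Q₁ U J J' I K) (hU : IsOpen U)
    (pos : ∀ p ∈ U, 0 < hkCosSq (fun i => J i p) (fun i => J' i p)) :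
    SmoothFormFamilyOn M U (fun t p => hkForm ![I p, projPath (fun i => J' i p) (K p) t,
      I p * projPath (fun i => J' i p) (K p) t]) := by
  have unit p (hp : p ∈ U) := (c.isCommonFrame p hp).unit
  have unit' p (hp : p ∈ U) :=
    ((c.isCommonFrame p hp).normalize_hkProj (finrank_tangentSpace_eq p) (pos p hp)).unit
  have nonneg p (hp : p ∈ U) := ((c.isCommonFrame p hp).endInner_normalize_hkProj_pos
    (finrank_tangentSpace_eq p) (pos p hp)).le
  have smooth' := c.smooth_endNormalize_hkProj hU pos
  refine SmoothEndFamilyOn.hkForm (J := fun i t p => ![I p, projPath (fun i => J' i p) (K p) t,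
    I p * projPath (fun i => J' i p) (K p) t] i) (fun i t ht p hp => ?_) fun i => ?_
  · exact (((c.isCommonFrame p hp).isHKTriple_projPath (finrank_tangentSpace_eq p) (pos p hp)
      ht).complex i).skew
  · fin_cases i
    exacts [c.smooth_common.smoothEndFamilyOn,
      c.smooth.smoothEndFamilyOn_normalize_lineMap hU smooth' unit unit' nonneg,
      c.smooth_common.smoothEndFamilyOn_mul_normalize_lineMap hU c.smooth smooth' unit unit' nonneg]

end AQHStructure.IsLocalCommonFrame

theorem AQHStructure.exists_local_homotopy [IsContMDiffRiemannianBundle (𝓡 8) ∞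
      (EuclideanSpace ℝ (Fin 8)) (fun p : M => TangentSpace (𝓡 8) p)] {Q₀ Q₁ : AQHStructure o}
    (hd : ∀ p, Module.finrank ℝ ↥(Q₀.E p ⊓ Q₁.E p) = 1)
    (hc : ∀ p, 7 / 15 < Real.cos (Q₀.angle Q₁ p)) (p₀ : M) :
    ∃ U : Set M, IsOpen U ∧ p₀ ∈ U ∧
      ∃ Ω : ℝ → FourFormField M, SmoothFormFamilyOn M U Ω ∧
        (∀ p ∈ U, Ω 0 p = Q₀.fundamentalForm p ∧ Ω 1 p = Q₁.fundamentalForm p) ∧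
        ∀ t ∈ Set.Icc (0 : ℝ) 1, ∀ p ∈ U, Ω t p ∈ hkForms (o.or p) := by
  obtain ⟨U, hU, hp₀, J, J', I, K, c⟩ := exists_isLocalCommonFrame hd p₀
  have pos p (hp : p ∈ U) := c.left.hkCosSq_pos c.right hp (hc p)
  refine ⟨U, hU, hp₀, _, c.smoothFormFamilyOn_projPath hU pos, fun p hp => ⟨?_, ?_⟩,
    fun t ht p hp => ⟨_, (c.isCommonFrame p hp).isHKTriple_projPath (finrank_tangentSpace_eq p)
      (pos p hp) ht, rfl⟩⟩
  · rw [c.left.fundamentalForm_eq hp]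
    exact (c.isCommonFrame p hp).hkForm_projPath_zero (finrank_tangentSpace_eq p)
  · rw [c.right.fundamentalForm_eq hp]
    exact (c.isCommonFrame p hp).hkForm_projPath_one (finrank_tangentSpace_eq p) (pos p hp)

end LocalHomotopy

end

theorem proposition11p3 {M : Type*} [TopologicalSpace M]
    [ChartedSpace (EuclideanSpace ℝ (Fin 8)) M] [IsManifold (𝓡 8) ∞ M]
    [RiemannianBundle (fun p : M => TangentSpace (𝓡 8) p)]
    [IsContMDiffRiemannianBundle (𝓡 8) ∞ (EuclideanSpace ℝ (Fin 8))
      (fun p : M => TangentSpace (𝓡 8) p)]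
    (o : ManifoldOrientation M) (Q₀ Q₁ : AQHStructure o) :
    ((∀ p : M, 1 ≤ Module.finrank ℝ ↥(Q₀.E p ⊓ Q₁.E p)) →
      ∃ Ω : ℝ → FourFormField M, SmoothFormFamilyOn M Set.univ Ω ∧
        Ω 0 = Q₀.fundamentalForm ∧ Ω 1 = Q₁.fundamentalForm ∧
        ∀ t ∈ Set.Icc (0 : ℝ) 1, ∀ p : M, IsSelfDual (o.or p) (Ω t p) ∧
          formInner (Ω t p) (Ω t p) = 10 / 3) ∧
    ((∀ p : M, Module.finrank ℝ ↥(Q₀.E p ⊓ Q₁.E p) = 1) →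
      (∀ p : M, 7 / 15 < Real.cos (Q₀.angle Q₁ p)) →
      ∀ p₀ : M, ∃ U : Set M, IsOpen U ∧ p₀ ∈ U ∧
        ∃ Ω : ℝ → FourFormField M, SmoothFormFamilyOn M U Ω ∧
          (∀ p ∈ U, Ω 0 p = Q₀.fundamentalForm p ∧ Ω 1 p = Q₁.fundamentalForm p) ∧
          ∀ t ∈ Set.Icc (0 : ℝ) 1, ∀ p ∈ U, Ω t p ∈ hkForms (o.or p)) := by
  constructor
  · intro hd
    refine ⟨Q₀.normalizedSegment Q₁, AQHStructure.smoothFormFamilyOn_normalizedSegment hd,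
      Q₀.normalizedSegment_zero Q₁, Q₀.normalizedSegment_one Q₁, fun t ht p => ⟨?_, ?_⟩⟩
    · exact Q₀.isSelfDual_normalizedSegment Q₁ t p
    · exact AQHStructure.formInner_normalizedSegment_self (hd p) ht
  · exact fun hd hc p₀ => AQHStructure.exists_local_homotopy hd hc p₀
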